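/- Let $A$ be an associative ring with unit; modules are right modules unless stated otherwise. A right $A$-module $M$ is \emph{coherent} if it is finitely generated and the kernel of every homomorphism $P\to M$ with $P$ a finitely generated free module is finitely generated; $A$ is right coherent if $A_A$ is coherent. For a graded ring $T$, \emph{graded coherent} right modules and \emph{graded right coherent} rings are defined in the same way with graded modules, degree-preserving homomorphisms and finitely generated graded free modules $P=\bigoplus_{j}T(-d_j)$, $d_j\in\mathbb Z$. A complex is \emph{pure} if its cohomology vanishes in all degrees $i\neq 0$. Let $A$ be a right coherent ring which has finite right global dimension and finite left global dimension. Let $\sigma$ be an $A$-$A$-bimodule which is finitely presented as a right $A$-module and such that, for every $n\ge 1$, the iterated derived tensor product $\sigma^{\otimes^{\mathbf L}_A n}$ is pure. Write $\sigma^0=A$ and $\sigma^n$ for $\sigma^{\otimes^{\mathbf L}_A n}$, which is then identified with the ordinary tensor power $\sigma^{\otimes_A n}$, and let $T_A(\sigma)=A\oplus\sigma\oplus\sigma^2\oplus\cdots$ be the tensor algebra, graded by $\deg\sigma=1$. Then the following conditions are equivalent: (1) $T_A(\sigma)$ is graded right coherent; (2) for every finitely presented right $A$-module $M$ there is a natural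 number $m\geq 0$ such that $(M\otimes_A\sigma^m)\otimes^{\mathbf L}_A\sigma^n$ is pure for all $n\ge 0$. -/

import Mathlib

open CategoryTheory MulOpposite
open scoped DirectSum TensorProduct

universe u v w

namespace GrCoh

/-! ## Tensor products over a noncommutative ring

Right `A`-modules are modules over `Aᵐᵒᵖ`, so that `x a` is written `op a • x`. -/

section Tensor

/-- The subgroup of `M ⊗[ℤ] N` generated by the elements `x a ⊗ y - x ⊗ a y`. -/
def balancing (A : Type u) [Ring A] (M : Type v) [AddCommGroup M] [Module Aᵐᵒᵖ M]
    (N : Type w) [AddCommGroup N] [Module A N] : AddSubgroup (M ⊗[ℤ] N) :=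
  AddSubgroup.closure
    {t | ∃ (x : M) (a : A) (y : N), t = (op a • x) ⊗ₜ[ℤ] y - x ⊗ₜ[ℤ] (a • y)}

/-- The tensor product `M ⊗_A N` of a right `A`-module `M` and a left `A`-module `N`. -/
def Tensor (A : Type u) [Ring A] (M : Type v) [AddCommGroup M] [Module Aᵐᵒᵖ M]
    (N : Type w) [AddCommGroup N] [Module A N] : Type (max v w) :=
  (M ⊗[ℤ] N) ⧸ balancing A M N

namespace Tensor

variable {A : Type u} [Ring A]
variable {M : Type v} [AddCommGroup M] [Module Aᵐᵒᵖ M]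
variable {N : Type w} [AddCommGroup N] [Module A N]

instance : AddCommGroup (Tensor A M N) :=
  inferInstanceAs (AddCommGroup ((M ⊗[ℤ] N) ⧸ balancing A M N))

/-- The quotient map from the tensor product over `ℤ`. -/
def mk (A : Type u) [Ring A] (M : Type v) [AddCommGroup M] [Module Aᵐᵒᵖ M]
    (N : Type w) [AddCommGroup N] [Module A N] : (M ⊗[ℤ] N) →+ Tensor A M N :=
  QuotientAddGroup.mk' (balancing A M N)

/-- The pure tensor `x ⊗ y`. -/
def tmul (A : Type u) [Ring A] {M : Type v} [AddCommGroup M] [Module Aᵐᵒᵖ M]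
    {N : Type w} [AddCommGroup N] [Module A N] (x : M) (y : N) : Tensor A M N :=
  mk A M N (x ⊗ₜ[ℤ] y)

theorem add_tmul (x x' : M) (y : N) : tmul A (x + x') y = tmul A x y + tmul A x' y := by
  simp only [tmul, TensorProduct.add_tmul, map_add]

theorem tmul_add (x : M) (y y' : N) : tmul A x (y + y') = tmul A x y + tmul A x y' := by
  simp only [tmul, TensorProduct.tmul_add, map_add]

theorem smul_tmul (a : A) (x : M) (y : N) : tmul A (op a • x) y = tmul A x (a • y) := by
  rw [← sub_eq_zero]
  simp only [tmul]
  rw [← map_sub]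
  exact (QuotientAddGroup.eq_zero_iff _).2 (AddSubgroup.subset_closure ⟨x, a, y, rfl⟩)

theorem tmul_zero (x : M) : tmul A x (0 : N) = 0 := by
  rw [tmul, TensorProduct.tmul_zero, map_zero]

theorem zero_tmul (y : N) : tmul A (0 : M) y = 0 := by
  rw [tmul, TensorProduct.zero_tmul, map_zero]

theorem induction {p : Tensor A M N → Prop} (h0 : p 0) (ht : ∀ x y, p (tmul A x y))
    (ha : ∀ s t, p s → p t → p (s + t)) (t : Tensor A M N) : p t := by
  obtain ⟨t, rfl⟩ : ∃ t', mk A M N t' = t := QuotientAddGroup.mk'_surjective (balancing A M N) t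
  induction t using TensorProduct.induction_on with
  | zero => rwa [map_zero]
  | tmul x y => exact ht x y
  | add s t hs ht => rw [map_add]; exact ha _ _ hs ht

theorem hom_ext {P : Type*} [AddCommGroup P] {f g : Tensor A M N →+ P}
    (h : ∀ x y, f (tmul A x y) = g (tmul A x y)) : f = g := by
  ext t
  induction t using Tensor.induction with
  | h0 => simp
  | ht x y => exact h x y
  | ha s t hs ht => rw [map_add, map_add, hs, ht]

/-- The universal property: `A`-balanced biadditive maps factor through `M ⊗_A N`. -/
def lift {P : Type*} [AddCommGroup P] (f : M →+ N →+ P)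
    (hf : ∀ (x : M) (a : A) (y : N), f (op a • x) y = f x (a • y)) : Tensor A M N →+ P :=
  QuotientAddGroup.lift (balancing A M N)
    (TensorProduct.liftAddHom f fun r x y => by simp)
    ((AddSubgroup.closure_le _).2 (by
      rintro _ ⟨x, a, y, rfl⟩
      simp [hf]))

@[simp]
theorem lift_tmul {P : Type*} [AddCommGroup P] (f : M →+ N →+ P)
    (hf : ∀ (x : M) (a : A) (y : N), f (op a • x) y = f x (a • y)) (x : M) (y : N) :
    lift f hf (tmul A x y) = f x y := rfl

/-- The additive map `f ⊗ g` for a right linear map `f` and a left linear map `g`. -/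
def map {M' : Type*} [AddCommGroup M'] [Module Aᵐᵒᵖ M'] {N' : Type*} [AddCommGroup N']
    [Module A N'] (f : M →ₗ[Aᵐᵒᵖ] M') (g : N →ₗ[A] N') : Tensor A M N →+ Tensor A M' N' :=
  lift (AddMonoidHom.mk' (fun x => AddMonoidHom.mk' (fun y => tmul A (f x) (g y))
      fun y y' => by rw [map_add, tmul_add])
      fun x x' => by ext y; simp [add_tmul])
    fun x a y => by simp [smul_tmul]

@[simp]
theorem map_tmul {M' : Type*} [AddCommGroup M'] [Module Aᵐᵒᵖ M'] {N' : Type*}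
    [AddCommGroup N'] [Module A N'] (f : M →ₗ[Aᵐᵒᵖ] M') (g : N →ₗ[A] N') (x : M) (y : N) :
    map f g (tmul A x y) = tmul A (f x) (g y) := rfl

section Left

variable [Module A M] [SMulCommClass A Aᵐᵒᵖ M]

/-- If `M` is a bimodule then `M ⊗_A N` is a left module by `a (x ⊗ y) = a x ⊗ y`. -/
instance : Module A (Tensor A M N) where
  smul a := map (Module.toModuleEnd Aᵐᵒᵖ M a) LinearMap.id
  smul_zero a := map_zero (map (Module.toModuleEnd Aᵐᵒᵖ M a) LinearMap.id)
  smul_add a := map_add (map (Module.toModuleEnd Aᵐᵒᵖ M a) LinearMap.id)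
  one_smul t := DFunLike.congr_fun (f := map (Module.toModuleEnd Aᵐᵒᵖ M (1 : A)) LinearMap.id)
    (g := AddMonoidHom.id (Tensor A M N)) (hom_ext fun x y => by simp) t
  mul_smul a b t := DFunLike.congr_fun
    (f := map (Module.toModuleEnd Aᵐᵒᵖ M (a * b)) LinearMap.id)
    (g := (map (Module.toModuleEnd Aᵐᵒᵖ M a) LinearMap.id).comp
      (map (N := N) (Module.toModuleEnd Aᵐᵒᵖ M b) LinearMap.id))
    (hom_ext fun x y => by simp [mul_smul]) t
  add_smul a b t := DFunLike.congr_fun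
    (f := map (Module.toModuleEnd Aᵐᵒᵖ M (a + b)) LinearMap.id)
    (g := map (Module.toModuleEnd Aᵐᵒᵖ M a) LinearMap.id +
      map (N := N) (Module.toModuleEnd Aᵐᵒᵖ M b) LinearMap.id)
    (hom_ext fun x y => by simp [add_smul, add_tmul]) t
  zero_smul t := DFunLike.congr_fun
    (f := map (Module.toModuleEnd Aᵐᵒᵖ M (0 : A)) LinearMap.id)
    (g := (0 : Tensor A M N →+ Tensor A M N))
    (hom_ext fun x y => by simp [zero_tmul]) t

theorem left_smul_tmul (a : A) (x : M) (y : N) : a • tmul A x y = tmul A (a • x) y := rfl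

end Left

section Right

variable [Module Aᵐᵒᵖ N] [SMulCommClass A Aᵐᵒᵖ N]

/-- Right multiplication by `b` on a bimodule, as a left linear map. -/
def rightMul (A : Type u) [Ring A] (N : Type w) [AddCommGroup N] [Module A N] [Module Aᵐᵒᵖ N]
    [SMulCommClass A Aᵐᵒᵖ N] (b : Aᵐᵒᵖ) : N →ₗ[A] N where
  toFun y := b • y
  map_add' := smul_add b
  map_smul' a y := (smul_comm a b y).symm

@[simp]
theorem rightMul_apply (b : Aᵐᵒᵖ) (y : N) : rightMul A N b y = b • y := rfl

/-- If `N` is a bimodule then `M ⊗_A N` is a right module by `(x ⊗ y) a = x ⊗ y a`. -/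
instance : Module Aᵐᵒᵖ (Tensor A M N) where
  smul b := map LinearMap.id (rightMul A N b)
  smul_zero b := map_zero (map LinearMap.id (rightMul A N b))
  smul_add b := map_add (map LinearMap.id (rightMul A N b))
  one_smul t := DFunLike.congr_fun (f := map LinearMap.id (rightMul A N 1))
    (g := AddMonoidHom.id (Tensor A M N)) (hom_ext fun x y => by simp) t
  mul_smul a b t := DFunLike.congr_fun
    (f := map LinearMap.id (rightMul A N (a * b)))
    (g := (map LinearMap.id (rightMul A N a)).comp (map (M := M) LinearMap.id (rightMul A N b)))
    (hom_ext fun x y => by simp [mul_smul]) t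
  add_smul a b t := DFunLike.congr_fun
    (f := map LinearMap.id (rightMul A N (a + b)))
    (g := map LinearMap.id (rightMul A N a) + map (M := M) LinearMap.id (rightMul A N b))
    (hom_ext fun x y => by simp [add_smul, tmul_add]) t
  zero_smul t := DFunLike.congr_fun
    (f := map LinearMap.id (rightMul A N 0))
    (g := (0 : Tensor A M N →+ Tensor A M N))
    (hom_ext fun x y => by simp [tmul_zero]) t

theorem right_smul_tmul (b : Aᵐᵒᵖ) (x : M) (y : N) : b • tmul A x y = tmul A x (b • y) := rfl

/-- The right linear map `f ⊗ id : M ⊗_A N → M' ⊗_A N`, for `N` a bimodule. -/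
def rTensor {M' : Type*} [AddCommGroup M'] [Module Aᵐᵒᵖ M'] (N : Type w) [AddCommGroup N]
    [Module A N] [Module Aᵐᵒᵖ N] [SMulCommClass A Aᵐᵒᵖ N] (f : M →ₗ[Aᵐᵒᵖ] M') :
    Tensor A M N →ₗ[Aᵐᵒᵖ] Tensor A M' N where
  toFun := map f LinearMap.id
  map_add' := map_add _
  map_smul' b t := DFunLike.congr_fun
    (f := (map f LinearMap.id).comp (map LinearMap.id (rightMul A N b)))
    (g := (map LinearMap.id (rightMul A N b)).comp (map (N := N) f LinearMap.id))
    (hom_ext fun x y => by simp) t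

@[simp]
theorem rTensor_tmul {M' : Type*} [AddCommGroup M'] [Module Aᵐᵒᵖ M'] (f : M →ₗ[Aᵐᵒᵖ] M')
    (x : M) (y : N) : rTensor N f (tmul A x y) = tmul A (f x) y := rfl

theorem right_hom_ext {P : Type*} [AddCommGroup P] [Module Aᵐᵒᵖ P]
    {f g : Tensor A M N →ₗ[Aᵐᵒᵖ] P}
    (h : ∀ x y, f (tmul A x y) = g (tmul A x y)) : f = g :=
  LinearMap.toAddMonoidHom_injective (hom_ext (f := f.toAddMonoidHom) (g := g.toAddMonoidHom) h)

theorem rTensor_id : rTensor N (LinearMap.id : M →ₗ[Aᵐᵒᵖ] M) = LinearMap.id :=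
  right_hom_ext fun _ _ => rfl

theorem rTensor_comp {M' : Type*} [AddCommGroup M'] [Module Aᵐᵒᵖ M'] {M'' : Type*}
    [AddCommGroup M''] [Module Aᵐᵒᵖ M''] (g : M' →ₗ[Aᵐᵒᵖ] M'') (f : M →ₗ[Aᵐᵒᵖ] M') :
    rTensor N (g ∘ₗ f) = rTensor N g ∘ₗ rTensor N f :=
  right_hom_ext fun _ _ => rfl

theorem rTensor_add {M' : Type*} [AddCommGroup M'] [Module Aᵐᵒᵖ M'] (f g : M →ₗ[Aᵐᵒᵖ] M') :
    rTensor N (f + g) = rTensor N f + rTensor N g :=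
  right_hom_ext fun _ _ => by simp [add_tmul]

instance [Module A M] [SMulCommClass A Aᵐᵒᵖ M] : SMulCommClass A Aᵐᵒᵖ (Tensor A M N) where
  smul_comm a b t := (map_smul (rTensor N (Module.toModuleEnd Aᵐᵒᵖ M a)) b t)

end Right

end Tensor

end Tensor

/-! ## Bimodules, tensor powers and the tensor algebra -/

/-- An `A`-`A`-bimodule. -/
structure Bimodule (A : Type u) [Ring A] where
  /-- The underlying type. -/
  carrier : Type u
  [addCommGroup : AddCommGroup carrier]
  [leftModule : Module A carrier]
  [rightModule : Module Aᵐᵒᵖ carrier]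
  [smulCommClass : SMulCommClass A Aᵐᵒᵖ carrier]

attribute [instance] Bimodule.addCommGroup Bimodule.leftModule Bimodule.rightModule
  Bimodule.smulCommClass

namespace Bimodule

variable {A : Type u} [Ring A]

instance : CoeSort (Bimodule A) (Type u) := ⟨carrier⟩

/-- The underived tensor powers: `σ^0 = A` and `σ^(n+1) = σ^n ⊗_A σ`. -/
def pow (σ : Bimodule A) : ℕ → Bimodule A
  | 0 => ⟨A⟩
  | n + 1 => ⟨Tensor A (pow σ n) σ⟩

/-- Left multiplication by `x ∈ σ^m` in the tensor algebra, `y ↦ x y : σ^n → σ^(m+n)`: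
`x · a = x a` for `a ∈ σ^0 = A`, and `x · (y ⊗ s) = (x · y) ⊗ s` for `y ∈ σ^n`, `s ∈ σ`. -/
def leftMul (σ : Bimodule A) {m : ℕ} (x : σ.pow m) :
    (n : ℕ) → (σ.pow n : Type u) →ₗ[Aᵐᵒᵖ] (σ.pow (m + n) : Type u)
  | 0 =>
    { toFun := fun a : A => op a • x
      map_add' := fun a b : A => add_smul (op a) (op b) x
      map_smul' := fun (b : Aᵐᵒᵖ) (a : A) => by
        change op (a * unop b) • x = b • op a • x
        rw [op_mul, op_unop, mul_smul] }
  | n + 1 => Tensor.rTensor σ (leftMul σ x n)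

/-- Transport along an equality of exponents. -/
def powCast (σ : Bimodule A) {m n : ℕ} (h : m = n) :
    (σ.pow m : Type u) →ₗ[Aᵐᵒᵖ] (σ.pow n : Type u) :=
  h ▸ LinearMap.id

theorem powCast_succ (σ : Bimodule A) {m n : ℕ} (h : m = n) (h' : m + 1 = n + 1) :
    σ.powCast h' = Tensor.rTensor σ (σ.powCast h) := by
  subst h
  exact Tensor.rTensor_id.symm

theorem mk_powCast (σ : Bimodule A) {m n : ℕ} (h : m = n) (x : σ.pow m) :
    (GradedMonoid.mk n (σ.powCast h x) : GradedMonoid fun n => (σ.pow n).carrier) =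
      GradedMonoid.mk m x := by
  subst h
  rfl

theorem leftMul_add (σ : Bimodule A) {m : ℕ} (x x' : σ.pow m) (n : ℕ) :
    σ.leftMul (x + x') n = σ.leftMul x n + σ.leftMul x' n := by
  induction n with
  | zero => exact LinearMap.ext fun a : A => smul_add (op a) x x'
  | succ n ih => exact (congrArg (Tensor.rTensor σ) ih).trans (Tensor.rTensor_add _ _)

theorem leftMul_one (σ : Bimodule A) (n : ℕ) (h : n = 0 + n) :
    σ.leftMul (m := 0) (1 : A) n = σ.powCast h := by
  induction n with
  | zero => exact LinearMap.ext fun a : A => one_mul a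
  | succ n ih =>
    rw [σ.powCast_succ (by omega : n = 0 + n) h, ← ih]
    rfl

theorem leftMul_leftMul (σ : Bimodule A) {m n : ℕ} (x : σ.pow m) (y : σ.pow n) (k : ℕ)
    (h : m + n + k = m + (n + k)) :
    σ.powCast h ∘ₗ σ.leftMul (σ.leftMul x n y) k = σ.leftMul x (n + k) ∘ₗ σ.leftMul y k := by
  induction k with
  | zero => exact LinearMap.ext fun a : A => ((σ.leftMul x n).map_smul (op a) y).symm
  | succ k ih =>
    rw [σ.powCast_succ (by omega : m + n + k = m + (n + k)) h]
    refine (Tensor.rTensor_comp _ _).symm.trans ?_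
    rw [ih (by omega)]
    exact Tensor.rTensor_comp _ _

/-- The multiplication of the tensor algebra, by concatenation of tensors. -/
instance (σ : Bimodule A) : GradedMonoid.GMul fun n => (σ.pow n).carrier where
  mul x y := σ.leftMul x _ y

/-- The unit of the tensor algebra is `1 ∈ A = σ^0`. -/
instance (σ : Bimodule A) : GradedMonoid.GOne fun n => (σ.pow n).carrier where
  one := (1 : A)

/-- The graded ring structure of the tensor algebra. -/
instance (σ : Bimodule A) : DirectSum.GRing fun n => (σ.pow n).carrier where
  mul_zero x := map_zero (σ.leftMul x _)
  zero_mul {i j} y := by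
    have h : σ.leftMul (0 : σ.pow i) j y = 0 := by
      simpa using congrArg (fun f => f y) (σ.leftMul_add (0 : σ.pow i) 0 j)
    exact h
  mul_add x := map_add (σ.leftMul x _)
  add_mul x x' y := congrArg (fun f => f y) (σ.leftMul_add x x' _)
  one_mul := by
    rintro ⟨n, x⟩
    have h : n = 0 + n := by omega
    refine Eq.trans ?_ (σ.mk_powCast h x)
    rw [← σ.leftMul_one n h]
    rfl
  mul_one := by
    rintro ⟨n, x⟩
    exact congrArg (GradedMonoid.mk n) (one_smul Aᵐᵒᵖ x)
  mul_assoc := by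
    rintro ⟨m, x⟩ ⟨n, y⟩ ⟨k, z⟩
    have h : m + n + k = m + (n + k) := by omega
    refine (σ.mk_powCast h (σ.leftMul (σ.leftMul x n y) k z)).symm.trans ?_
    exact congrArg (GradedMonoid.mk (m + (n + k)))
      (congrArg (fun f => f z) (σ.leftMul_leftMul x y k h))
  natCast n := (n : A)
  natCast_zero := Nat.cast_zero (R := A)
  natCast_succ n := Nat.cast_succ (R := A) n
  intCast n := (n : A)
  intCast_ofNat n := Int.cast_natCast (R := A) n
  intCast_negSucc_ofNat n := Int.cast_negSucc (R := A) n

/-- The tensor algebra `T_A(σ) = A ⊕ σ ⊕ σ^2 ⊕ ⋯`. -/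
abbrev TensorAlg (σ : Bimodule A) : Type u := ⨁ n, (σ.pow n).carrier

/-- The grading of `T_A(σ)` with `deg σ = 1`, as a `ℤ`-grading: the component of degree `n ≥ 0`
is `σ^n`, and the components of negative degree are zero. -/
def grading (σ : Bimodule A) : ℤ → AddSubgroup σ.TensorAlg
  | Int.ofNat n => (DirectSum.of (fun n => (σ.pow n).carrier) n).range
  | Int.negSucc _ => ⊥

end Bimodule

/-! ## Coherence and graded coherence -/

/-- A right `A`-module `M` is coherent if it is finitely generated and the kernel of each
homomorphism from a finitely generated free module to `M` is finitely generated. -/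
def IsCoherentModule (A : Type u) [Ring A] (M : Type v) [AddCommGroup M] [Module Aᵐᵒᵖ M] : Prop :=
  Module.Finite Aᵐᵒᵖ M ∧
    ∀ (k : ℕ) (f : (Fin k → A) →ₗ[Aᵐᵒᵖ] M), (LinearMap.ker f).FG

/-- A ring is right coherent if it is coherent as a right module over itself. -/
def IsRightCoherent (A : Type u) [Ring A] : Prop := IsCoherentModule A A

/-- The grading of the graded free right module `⨁ⱼ T(-dⱼ)`, whose component of degree `n` is
`⨁ⱼ T_{n - dⱼ}`, for a ring `T` with grading `𝒯`. -/
def freeGrading {T : Type u} [Ring T] (𝒯 : ℤ → AddSubgroup T) {k : ℕ} (d : Fin k → ℤ) (n : ℤ) :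
    AddSubgroup (Fin k → T) :=
  AddSubgroup.pi Set.univ fun j => 𝒯 (n - d j)

/-- For a graded ring `(T, 𝒯)`, a graded right module `(M, ℳ)` is graded coherent if it is
finitely generated and the kernel of each degree-preserving homomorphism from a finitely generated
graded free module to `M` is finitely generated. -/
def IsGradedCoherentModule {T : Type u} [Ring T] (𝒯 : ℤ → AddSubgroup T)
    {M : Type v} [AddCommGroup M] [Module Tᵐᵒᵖ M] (ℳ : ℤ → AddSubgroup M) : Prop :=
  Module.Finite Tᵐᵒᵖ M ∧
    ∀ (k : ℕ) (d : Fin k → ℤ) (f : (Fin k → T) →ₗ[Tᵐᵒᵖ] M),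
      (∀ n, ∀ p ∈ freeGrading 𝒯 d n, f p ∈ ℳ n) → (LinearMap.ker f).FG

/-- A graded ring is graded right coherent if it is graded coherent as a right module over
itself. -/
def IsGradedRightCoherent {T : Type u} [Ring T] (𝒯 : ℤ → AddSubgroup T) : Prop :=
  IsGradedCoherentModule 𝒯 𝒯

/-! ## Global dimension -/

/-- Finite left global dimension: the projective dimensions of the left modules are bounded. -/
def FiniteLeftGlobalDim (A : Type u) [Ring A] : Prop :=
  ∃ d : ℕ, ∀ M : ModuleCat.{u} A, HasProjectiveDimensionLE M d

/-- Finite right global dimension: the projective dimensions of the right modules are bounded. -/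
def FiniteRightGlobalDim (A : Type u) [Ring A] : Prop :=
  ∃ d : ℕ, ∀ M : ModuleCat.{u} Aᵐᵒᵖ, HasProjectiveDimensionLE M d

/-! ## Derived tensor products and purity

Complexes concentrated in nonpositive cohomological degrees are written as chain complexes indexed
by `ℕ`, so that `X.homology i` is the cohomology of `X` in degree `-i`. -/

section Derived

variable {A : Type u} [Ring A]

/-- The functor `- ⊗_A N` from right modules to right modules, for a bimodule `N`. -/
def tensorFunctor (N : Bimodule A) : ModuleCat.{u} Aᵐᵒᵖ ⥤ ModuleCat.{u} Aᵐᵒᵖ where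
  obj M := ModuleCat.of Aᵐᵒᵖ (Tensor A M N)
  map f := ModuleCat.ofHom (Tensor.rTensor N f.hom)
  map_id _ := ModuleCat.hom_ext Tensor.rTensor_id
  map_comp f g := ModuleCat.hom_ext (Tensor.rTensor_comp g.hom f.hom)

instance (N : Bimodule A) : (tensorFunctor N).Additive where
  map_add {_ _ f g} := ModuleCat.hom_ext (Tensor.rTensor_add f.hom g.hom)

/-- Two complexes are quasi-isomorphic if they are joined by a zigzag of quasi-isomorphisms. -/
def QuasiIsomorphic (X Y : ChainComplex (ModuleCat.{u} Aᵐᵒᵖ) ℕ) : Prop :=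
  Relation.EqvGen (fun X Y : ChainComplex (ModuleCat.{u} Aᵐᵒᵖ) ℕ => ∃ f : X ⟶ Y, QuasiIso f) X Y

/-- A right module, viewed as a complex concentrated in degree `0`. -/
noncomputable def asComplex (M : ModuleCat.{u} Aᵐᵒᵖ) : ChainComplex (ModuleCat.{u} Aᵐᵒᵖ) ℕ :=
  (ChainComplex.single₀ (ModuleCat.{u} Aᵐᵒᵖ)).obj M

/-- A complex is pure if its cohomology vanishes outside degree `0`. -/
def IsPure (X : ChainComplex (ModuleCat.{u} Aᵐᵒᵖ) ℕ) : Prop :=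
  ∀ i, i ≠ 0 → Limits.IsZero (X.homology i)

/-- `Y` represents `X ⊗^L_A N` in the derived category of right modules: it is quasi-isomorphic
to `P ⊗_A N` for a complex `P` of projective modules that is quasi-isomorphic to `X`. -/
def IsDerivedTensor (X : ChainComplex (ModuleCat.{u} Aᵐᵒᵖ) ℕ) (N : Bimodule A)
    (Y : ChainComplex (ModuleCat.{u} Aᵐᵒᵖ) ℕ) : Prop :=
  ∃ P : ChainComplex (ModuleCat.{u} Aᵐᵒᵖ) ℕ, (∀ i, Projective (P.X i)) ∧
    QuasiIsomorphic P X ∧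
    QuasiIsomorphic (((tensorFunctor N).mapHomologicalComplex (ComplexShape.down ℕ)).obj P) Y

/-- `Y` represents the iterated derived tensor product `σ ⊗^L_A ⋯ ⊗^L_A σ` with `n` factors
(for `n = 0` it represents `A`), as a complex of right modules. -/
def IsDerivedPower (σ : Bimodule A) : ℕ → ChainComplex (ModuleCat.{u} Aᵐᵒᵖ) ℕ → Prop
  | 0, Y => QuasiIsomorphic (asComplex (ModuleCat.of Aᵐᵒᵖ A)) Y
  | n + 1, Y => ∃ X, IsDerivedPower σ n X ∧ IsDerivedTensor X σ Y

/-- The iterated derived tensor product of `n` copies of `σ` is pure. -/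
def DerivedPowerPure (σ : Bimodule A) (n : ℕ) : Prop :=
  ∀ Y, IsDerivedPower σ n Y → IsPure Y

/-- The derived tensor product `M ⊗^L_A N` of a right module and a bimodule is pure. -/
def DerivedTensorPure (M : ModuleCat.{u} Aᵐᵒᵖ) (N : Bimodule A) : Prop :=
  ∀ Y, IsDerivedTensor (asComplex M) N Y → IsPure Y

end Derived

end GrCoh

/-! Write N* for the group of characters of a bimodule N with values in ℚ/ℤ. Since ℚ/ℤ is an
injective cogenerator and characters of M ⊗ N are linear maps M → N*, the vanishing of Tor_i(M, N)
is equivalent to that of Ext^i(M, N*). All Tor statements are phrased this way, through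
`Tensor.exact_rTensor_iff`, so purity of M ⊗^L N becomes a condition on M alone
(`derivedTensorPure_iff`). The purity of the derived powers of σ yields Tor_i(σ^n, σ^k) = 0 for all
i ≥ 1 and all n, k (`extZero_pow_pow`).

Let T be the tensor algebra and f : F → G a graded map of finitely generated graded free T-modules,
with kernel Z, image I and cokernel C. Once m is at least every generator degree of F,
multiplication identifies F_m ⊗ σ^n with F_(m+n), and the map I_m ⊗ σ^n → I_(m+n) is onto. Its
injectivity means that Z_(m+n) = Z_m σ^n (`mulSub_imPart_injective`, `kerPart_le_range`). When
Tor_1(G_m, σ^n) = 0, it also means that Tor_1(C_m, σ^n) = 0 (`extZero_cokPart_iff`). Thus generation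
of the kernel in bounded degrees is a Tor_1 condition on one graded piece of the cokernel. If m also
bounds the generator degrees of G, then C_m ⊗ σ^n = C_(m+n).

From purity to coherence: condition (2) for the finitely presented module C_N, with N large, gives
an m with Tor_1(C_(N+m), σ^n) = 0 for all n. The kernel is then generated in degrees at most N + m,
and each of its graded pieces is finitely generated because A is coherent.

From coherence to purity: a presentation of M extends to a map T^s → T^r whose cokernel has M ⊗ σ^m
in degree m. Its kernel is generated in degrees at most some N, so Tor_1(M ⊗ σ^m, σ^k) = 0 for m ≥
N, and the image in degree N + j is K ⊗ σ^j with K = I_N finitely presented. Hence Tor_(i+2)(M ⊗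
σ^(N+j), σ^k) vanishes as soon as Tor_(i+1)(K ⊗ σ^j, σ^k) does (`exists_eventual_syzygy`). Induction
on i handles each degree with its own bound on m, and finite right global dimension leaves finitely
many degrees. -/

namespace GrCoh

/-! ## Vanishing of `Ext` and short exact sequences of linear maps -/

section ExtZero

variable {R : Type u} [Ring R]

/-- The group `Ext^i_R(M, D)` vanishes. -/
def ExtZero (D : ModuleCat.{u} R) (i : ℕ) (M : Type u) [AddCommGroup M] [Module R M] : Prop :=
  Subsingleton (Abelian.Ext (ModuleCat.of R M) D i)

/-- Every linear map `K → D` extends along `f : K → L`. -/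
def Extends (D : ModuleCat.{u} R) {K L : Type u} [AddCommGroup K] [Module R K]
    [AddCommGroup L] [Module R L] (f : K →ₗ[R] L) : Prop :=
  ∀ φ : K →ₗ[R] D, ∃ ψ : L →ₗ[R] D, ψ ∘ₗ f = φ

variable {D : ModuleCat.{u} R}
variable {K L M : Type u} [AddCommGroup K] [Module R K] [AddCommGroup L] [Module R L]
  [AddCommGroup M] [Module R M]

theorem extZero_of_iso {X Y : ModuleCat.{u} R} (e : X ≅ Y) {i : ℕ}
    (h : Subsingleton (Abelian.Ext X D i)) : Subsingleton (Abelian.Ext Y D i) := by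
  refine ⟨fun x y => ?_⟩
  have key : ∀ z : Abelian.Ext Y D i, z = 0 := fun z => by
    rw [← z.mk₀_id_comp, ← e.inv_hom_id, ← Abelian.Ext.mk₀_comp_mk₀_assoc,
      h.elim ((Abelian.Ext.mk₀ e.hom).comp z (zero_add i)) 0, Abelian.Ext.comp_zero]
  rw [key x, key y]

theorem ExtZero.of_equiv {i : ℕ} (e : L ≃ₗ[R] M) (h : ExtZero D i L) : ExtZero D i M :=
  extZero_of_iso e.toModuleIso h

theorem extZero_of_projective [Module.Projective R M] (i : ℕ) : ExtZero D (i + 1) M := by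
  have : Projective (ModuleCat.of R M) := inferInstance
  exact Abelian.Ext.subsingleton_of_projective _ _ i

theorem extZero_of_subsingleton [Subsingleton M] (i : ℕ) : ExtZero D i M := by
  have h : Limits.IsZero (ModuleCat.of R M) := ModuleCat.isZero_of_subsingleton _
  have := h.hasProjectiveDimensionLT_zero
  exact HasProjectiveDimensionLT.subsingleton _ 0 i (Nat.zero_le i) D

theorem shortExact_of_linearMap {f : K →ₗ[R] L} {g : L →ₗ[R] M} (hf : Function.Injective f)
    (hfg : Function.Exact f g) (hg : Function.Surjective g) :
    (ModuleCat.shortComplexOfCompEqZero f g hfg.linearMap_comp_eq_zero).ShortExact :=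
  ModuleCat.shortComplex_shortExact _ hfg hf hg

variable {f : K →ₗ[R] L} {g : L →ₗ[R] M}

/-- `Ext^i(K) = 0` and `Ext^(i+1)(L) = 0` imply `Ext^(i+1)(M) = 0`. -/
theorem ExtZero.right (hf : Function.Injective f) (hfg : Function.Exact f g)
    (hg : Function.Surjective g) {i : ℕ} (hK : ExtZero D i K) (hL : ExtZero D (i + 1) L) :
    ExtZero D (i + 1) M := by
  have hS := shortExact_of_linearMap hf hfg hg
  have key : ∀ z : Abelian.Ext (ModuleCat.of R M) D (i + 1), z = 0 := fun z => by
    obtain ⟨x, hx⟩ := Abelian.Ext.contravariant_sequence_exact₃ hS D z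
      (hL.elim _ _) (n₀ := i) (by omega)
    rw [← hx, hK.elim x 0, Abelian.Ext.comp_zero]
  exact ⟨fun x y => by rw [key x, key y]⟩

/-- `Ext^i(L) = 0` and `Ext^(i+1)(M) = 0` imply `Ext^i(K) = 0`. -/
theorem ExtZero.left (hf : Function.Injective f) (hfg : Function.Exact f g)
    (hg : Function.Surjective g) {i : ℕ} (hL : ExtZero D i L) (hM : ExtZero D (i + 1) M) :
    ExtZero D i K := by
  have hS := shortExact_of_linearMap hf hfg hg
  have key : ∀ z : Abelian.Ext (ModuleCat.of R K) D i, z = 0 := fun z => by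
    obtain ⟨x, hx⟩ := Abelian.Ext.contravariant_sequence_exact₁ hS D z (n₁ := i + 1) (by omega)
      (hM.elim _ _)
    rw [← hx, hL.elim x 0, Abelian.Ext.comp_zero]
  exact ⟨fun x y => by rw [key x, key y]⟩

/-- `Ext^i(K) = 0` and `Ext^i(M) = 0` imply `Ext^i(L) = 0`. -/
theorem ExtZero.middle (hf : Function.Injective f) (hfg : Function.Exact f g)
    (hg : Function.Surjective g) {i : ℕ} (hK : ExtZero D i K) (hM : ExtZero D i M) :
    ExtZero D i L := by
  have hS := shortExact_of_linearMap hf hfg hg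
  have key : ∀ z : Abelian.Ext (ModuleCat.of R L) D i, z = 0 := fun z => by
    obtain ⟨x, hx⟩ := Abelian.Ext.contravariant_sequence_exact₂ hS D z (hK.elim _ _)
    rw [← hx, hM.elim x 0, Abelian.Ext.comp_zero]
  exact ⟨fun x y => by rw [key x, key y]⟩

/-- If `Ext^1(M, D) = 0`, maps to `D` extend along the kernel of `L → M`. -/
theorem ExtZero.extends (hf : Function.Injective f) (hfg : Function.Exact f g)
    (hg : Function.Surjective g) (hM : ExtZero D 1 M) : Extends D f := by
  intro φ
  have hS := shortExact_of_linearMap hf hfg hg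
  obtain ⟨x, hx⟩ := Abelian.Ext.contravariant_sequence_exact₁ hS D
    (Abelian.Ext.mk₀ (ModuleCat.ofHom φ)) (n₁ := 1) (by omega) (hM.elim _ _)
  obtain ⟨ψ, rfl⟩ := (Abelian.Ext.mk₀_bijective _ _).2 x
  rw [Abelian.Ext.mk₀_comp_mk₀] at hx
  exact ⟨ψ.hom, congrArg ModuleCat.Hom.hom ((Abelian.Ext.mk₀_bijective _ _).1 hx)⟩

/-- If `Ext^1(L, D) = 0` and maps to `D` extend along the kernel of `L → M`, then
`Ext^1(M, D) = 0`. -/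
theorem ExtZero.of_extends (hf : Function.Injective f) (hfg : Function.Exact f g)
    (hg : Function.Surjective g) (hL : ExtZero D 1 L) (h : Extends D f) : ExtZero D 1 M := by
  have hS := shortExact_of_linearMap hf hfg hg
  have key : ∀ z : Abelian.Ext (ModuleCat.of R M) D 1, z = 0 := fun z => by
    obtain ⟨x, hx⟩ := Abelian.Ext.contravariant_sequence_exact₃ hS D z
      (hL.elim _ _) (n₀ := 0) (by omega)
    obtain ⟨φ, rfl⟩ := (Abelian.Ext.mk₀_bijective _ _).2 x
    obtain ⟨ψ, hψ⟩ := h φ.hom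
    have hφ : φ = ModuleCat.ofHom f ≫ ModuleCat.ofHom ψ := ModuleCat.hom_ext hψ.symm
    rw [← hx, hφ, ← Abelian.Ext.mk₀_comp_mk₀]
    exact hS.extClass_comp_assoc _
  exact ⟨fun x y => by rw [key x, key y]⟩

/-- Coordinate 0 is split off by the sequence M → M^(r+1) → M^r. -/
theorem ExtZero.pi {i : ℕ} (h : ExtZero D i M) (r : ℕ) : ExtZero D i (Fin r → M) := by
  induction r with
  | zero => exact extZero_of_subsingleton i
  | succ r ih =>
    refine ExtZero.middle (f := LinearMap.single R (fun _ : Fin (r + 1) => M) 0)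
      (g := LinearMap.funLeft R M Fin.succ)
      (Pi.single_injective (M := fun _ : Fin (r + 1) => M) 0) ?_ ?_ h ih
    · intro x
      constructor
      · intro hx
        refine ⟨x 0, funext fun j => ?_⟩
        refine Fin.cases ?_ (fun j => ?_) j
        · simp
        · simpa using (congrFun hx j).symm
      · rintro ⟨y, rfl⟩
        ext j
        simp [LinearMap.funLeft_apply]
    · exact LinearMap.funLeft_surjective_of_injective R M _ (Fin.succ_injective r)

end ExtZero

end GrCoh

namespace GrCoh

/-! ## Character modules and exactness of tensor products -/

/-- The character group of a left module. -/
def Dual (N : Type u) [AddCommGroup N] : Type u := N →+ AddCircle (1 : ℚ)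

namespace Dual

variable {A : Type u} [Ring A] {N : Type u} [AddCommGroup N] [Module A N]

instance : AddCommGroup (Dual N) := inferInstanceAs (AddCommGroup (N →+ AddCircle (1 : ℚ)))

/-- The additive map underlying a character. -/
def toHom : Dual N ≃+ (N →+ AddCircle (1 : ℚ)) := AddEquiv.refl _

/-- The character group of a left module is a right module by `(χ a)(y) = χ(a y)`. -/
instance : Module Aᵐᵒᵖ (Dual N) where
  smul a χ := toHom.symm ((toHom χ).comp (DistribSMul.toAddMonoidHom N (unop a)))
  one_smul χ := toHom.injective (AddMonoidHom.ext fun y => congrArg (toHom χ) (one_smul A y))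
  mul_smul a b χ := toHom.injective
    (AddMonoidHom.ext fun y => congrArg (toHom χ) (mul_smul (unop b) (unop a) y))
  smul_zero _ := rfl
  smul_add _ _ _ := rfl
  add_smul a b χ := toHom.injective (AddMonoidHom.ext fun y =>
    (congrArg (toHom χ) (add_smul (unop a) (unop b) y)).trans (map_add (toHom χ) _ _))
  zero_smul χ := toHom.injective (AddMonoidHom.ext fun y =>
    (congrArg (toHom χ) (zero_smul A y)).trans (map_zero (toHom χ)))

end Dual

/-- The character module of a bimodule, as a right module. -/
abbrev dualModule {A : Type u} [Ring A] (N : Bimodule A) : ModuleCat.{u} Aᵐᵒᵖ :=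
  ModuleCat.of Aᵐᵒᵖ (Dual N)

namespace Tensor

variable {A : Type u} [Ring A] {N : Bimodule A}
variable {K L M : Type u} [AddCommGroup K] [Module Aᵐᵒᵖ K] [AddCommGroup L] [Module Aᵐᵒᵖ L]
  [AddCommGroup M] [Module Aᵐᵒᵖ M]

/-- The character of `M ⊗ N` given by a linear map from `M` to the character module of `N`. -/
def toCharacter (φ : M →ₗ[Aᵐᵒᵖ] dualModule N) : Tensor A M N →+ AddCircle (1 : ℚ) :=
  lift ((Dual.toHom (N := N)).toAddMonoidHom.comp φ.toAddMonoidHom) fun x a y =>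
    DFunLike.congr_fun (congrArg Dual.toHom (map_smul φ (op a) x)) y

/-- The linear map from `M` to the character module of `N` given by a character of `M ⊗ N`. -/
def ofCharacter (χ : Tensor A M N →+ AddCircle (1 : ℚ)) : M →ₗ[Aᵐᵒᵖ] dualModule N where
  toFun x := Dual.toHom.symm
    (AddMonoidHom.mk' (fun y => χ (tmul A x y)) fun y y' => by rw [tmul_add, map_add])
  map_add' x x' := Dual.toHom.injective <| AddMonoidHom.ext fun y => by
    change χ (tmul A (x + x') y) = χ (tmul A x y) + χ (tmul A x' y)
    rw [add_tmul, map_add]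
  map_smul' a x := Dual.toHom.injective <| AddMonoidHom.ext fun y => by
    change χ (tmul A (op (unop a) • x) y) = χ (tmul A x (unop a • y))
    rw [smul_tmul]

theorem toCharacter_ofCharacter (χ : Tensor A M N →+ AddCircle (1 : ℚ)) :
    toCharacter (ofCharacter χ) = χ :=
  hom_ext fun _ _ => rfl

theorem ofCharacter_toCharacter (φ : M →ₗ[Aᵐᵒᵖ] dualModule N) :
    ofCharacter (toCharacter φ) = φ := rfl

theorem toCharacter_comp (φ : L →ₗ[Aᵐᵒᵖ] dualModule N) (f : K →ₗ[Aᵐᵒᵖ] L) (t : Tensor A K N) :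
    toCharacter (φ ∘ₗ f) t = toCharacter φ (rTensor N f t) :=
  DFunLike.congr_fun (f := toCharacter (φ ∘ₗ f))
    (g := (toCharacter φ).comp (rTensor N f).toAddMonoidHom) (hom_ext fun _ _ => rfl) t

/-- Exactness of `K ⊗ N → L ⊗ N → M ⊗ N` can be checked on maps to the character module. -/
theorem exact_rTensor_iff {f : K →ₗ[Aᵐᵒᵖ] L} {g : L →ₗ[Aᵐᵒᵖ] M} (hgf : g ∘ₗ f = 0) :
    Function.Exact (rTensor N f) (rTensor N g) ↔
      ∀ φ : L →ₗ[Aᵐᵒᵖ] dualModule N, φ ∘ₗ f = 0 → ∃ ψ : M →ₗ[Aᵐᵒᵖ] dualModule N, ψ ∘ₗ g = φ := by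
  constructor
  · intro h φ hφ
    have hk : (rTensor N g).toAddMonoidHom.ker ≤ (toCharacter φ).ker := by
      intro t ht
      obtain ⟨s, rfl⟩ := (h t).1 ht
      rw [AddMonoidHom.mem_ker, ← toCharacter_comp, hφ]
      exact DFunLike.congr_fun (f := toCharacter (0 : K →ₗ[Aᵐᵒᵖ] dualModule N)) (g := 0)
        (hom_ext fun _ _ => rfl) s
    -- The character of `φ` kills the kernel of L ⊗ N → M ⊗ N, so it lives on the image and extends
    -- to M ⊗ N by injectivity of ℚ/ℤ.
    let e := QuotientAddGroup.kerLift (rTensor N g).toAddMonoidHom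
    let χ : (Tensor A L N) ⧸ (rTensor N g).toAddMonoidHom.ker →+ AddCircle (1 : ℚ) :=
      QuotientAddGroup.lift _ (toCharacter φ) hk
    obtain ⟨χ', hχ'⟩ := CharacterModule.dual_surjective_of_injective e.toIntLinearMap
      (QuotientAddGroup.kerLift_injective _) χ
    refine ⟨ofCharacter χ', ?_⟩
    rw [← ofCharacter_toCharacter φ]
    refine LinearMap.ext fun x => Dual.toHom.injective <| AddMonoidHom.ext fun y => ?_
    exact DFunLike.congr_fun (F := CharacterModule _) hχ' (QuotientAddGroup.mk (tmul A x y))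
  · intro h
    refine (Function.Exact.of_comp_of_mem_range ?_ ?_)
    · funext s
      change rTensor N g (rTensor N f s) = 0
      rw [← LinearMap.comp_apply, ← rTensor_comp, hgf]
      exact DFunLike.congr_fun (f := (rTensor N (0 : K →ₗ[Aᵐᵒᵖ] M))) (g := 0)
        (right_hom_ext fun _ _ => by simp [zero_tmul]) s
    · intro t ht
      by_contra hn
      -- An element outside the image of K ⊗ N is detected by a character killing that image. By
      -- hypothesis such a character factors through M ⊗ N, where `t` becomes zero.
      have hne : (QuotientAddGroup.mk t :
          Tensor A L N ⧸ (rTensor N f).toAddMonoidHom.range) ≠ 0 := by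
        rw [Ne, QuotientAddGroup.eq_zero_iff]
        exact hn
      obtain ⟨c, hc⟩ := CharacterModule.exists_character_apply_ne_zero_of_ne_zero hne
      apply hc
      let χ : Tensor A L N →+ AddCircle (1 : ℚ) :=
        AddMonoidHom.comp (c : _ →+ AddCircle (1 : ℚ)) (QuotientAddGroup.mk' _)
      have h0 : ofCharacter χ ∘ₗ f = 0 := by
        refine LinearMap.ext fun x => Dual.toHom.injective <| AddMonoidHom.ext fun y => ?_
        change c (QuotientAddGroup.mk (tmul A (f x) y)) = 0
        have hm : tmul A (f x) y ∈ (rTensor N f).toAddMonoidHom.range := ⟨tmul A x y, rfl⟩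
        rw [(QuotientAddGroup.eq_zero_iff (tmul A (f x) y)).2 hm]
        exact map_zero c
      obtain ⟨ψ, hψ⟩ := h _ h0
      change χ t = 0
      rw [← toCharacter_ofCharacter χ, ← hψ, toCharacter_comp, ht, map_zero]

/-- Right exactness of the tensor product. -/
theorem exact_rTensor {f : K →ₗ[Aᵐᵒᵖ] L} {g : L →ₗ[Aᵐᵒᵖ] M} (hfg : Function.Exact f g)
    (hg : Function.Surjective g) : Function.Exact (rTensor N f) (rTensor N g) := by
  rw [exact_rTensor_iff hfg.linearMap_comp_eq_zero]
  intro φ hφ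
  have hk : LinearMap.ker g ≤ LinearMap.ker φ := by
    intro x hx
    obtain ⟨y, rfl⟩ := (hfg x).1 hx
    exact DFunLike.congr_fun hφ y
  refine ⟨(LinearMap.ker g).liftQ φ hk ∘ₗ (g.quotKerEquivOfSurjective hg).symm.toLinearMap, ?_⟩
  ext x
  have : (g.quotKerEquivOfSurjective hg).symm (g x) = (LinearMap.ker g).mkQ x := by
    rw [LinearEquiv.symm_apply_eq]; rfl
  simp [this]

theorem rTensor_surjective {g : L →ₗ[Aᵐᵒᵖ] M} (hg : Function.Surjective g) :
    Function.Surjective (rTensor N g) := by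
  intro t
  induction t using Tensor.induction with
  | h0 => exact ⟨0, map_zero _⟩
  | ht x y =>
    obtain ⟨x, rfl⟩ := hg x
    exact ⟨tmul A x y, rfl⟩
  | ha s t hs ht =>
    obtain ⟨s, rfl⟩ := hs
    obtain ⟨t, rfl⟩ := ht
    exact ⟨s + t, map_add _ _ _⟩

/-- `K ⊗ N → L ⊗ N` is injective if and only if maps from `K` to the character module of `N`
extend to `L`. -/
theorem rTensor_injective_iff {f : K →ₗ[Aᵐᵒᵖ] L} :
    Function.Injective (rTensor N f) ↔ Extends (dualModule N) f := by
  -- Injectivity is exactness at K of 0 → K → L, tensored with N.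
  have h := exact_rTensor_iff (N := N) (f := (0 : PUnit.{u + 1} →ₗ[Aᵐᵒᵖ] K)) (g := f)
    (LinearMap.comp_zero f)
  have h0 : rTensor N (0 : PUnit.{u + 1} →ₗ[Aᵐᵒᵖ] K) = 0 :=
    right_hom_ext fun _ _ => by simp [zero_tmul]
  rw [h0] at h
  constructor
  · intro hi φ
    refine h.1 ?_ φ (LinearMap.comp_zero φ)
    intro x
    rw [map_eq_zero_iff _ hi]
    constructor
    · rintro rfl; exact ⟨0, rfl⟩
    · rintro ⟨y, rfl⟩; rfl
  · intro he
    rw [injective_iff_map_eq_zero]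
    intro x hx
    obtain ⟨y, rfl⟩ := (h.2 (fun φ _ => he φ) x).1 hx
    rfl

/-- A linear equivalence induces a linear equivalence of tensor products. -/
def rTensorEquiv (N : Bimodule A) (e : L ≃ₗ[Aᵐᵒᵖ] M) : Tensor A L N ≃ₗ[Aᵐᵒᵖ] Tensor A M N :=
  LinearEquiv.ofLinearMap (rTensor N e.toLinearMap) (rTensor N e.symm.toLinearMap)
    (by rw [← rTensor_comp]; simp [rTensor_id]) (by rw [← rTensor_comp]; simp [rTensor_id])

end Tensor

end GrCoh

namespace GrCoh

/-! ## Purity of derived tensor products in terms of `Ext` -/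

section Complexes

variable {R : Type u} [Ring R]

/-- The cokernel of the differential `X_(j+1) → X_j`. -/
abbrev Syzygy (X : ChainComplex (ModuleCat.{u} R) ℕ) (j : ℕ) : Type u :=
  X.X j ⧸ LinearMap.range (X.d (j + 1) j).hom

/-- The map from the cokernel of `X_(j+2) → X_(j+1)` to `X_j` induced by the differential. -/
def Syzygy.incl (X : ChainComplex (ModuleCat.{u} R) ℕ) (j : ℕ) : Syzygy X (j + 1) →ₗ[R] X.X j :=
  (LinearMap.range (X.d (j + 2) (j + 1)).hom).liftQ (X.d (j + 1) j).hom (by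
    rintro _ ⟨x, rfl⟩
    rw [LinearMap.mem_ker, ← LinearMap.comp_apply, ← ModuleCat.hom_comp, X.d_comp_d]
    rfl)

theorem exactAt_succ_iff (X : ChainComplex (ModuleCat.{u} R) ℕ) (j : ℕ) :
    X.ExactAt (j + 1) ↔ Function.Exact (X.d (j + 2) (j + 1)).hom (X.d (j + 1) j).hom := by
  rw [HomologicalComplex.exactAt_iff' _ (j + 2) (j + 1) j (by simp) (by simp)]
  exact ShortComplex.ShortExact.moduleCat_exact_iff_function_exact _

theorem Syzygy.incl_injective {X : ChainComplex (ModuleCat.{u} R) ℕ} {j : ℕ}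
    (h : X.ExactAt (j + 1)) : Function.Injective (Syzygy.incl X j) := by
  rw [exactAt_succ_iff] at h
  rw [injective_iff_map_eq_zero]
  intro x hx
  obtain ⟨x, rfl⟩ := Submodule.mkQ_surjective _ x
  exact (Submodule.Quotient.mk_eq_zero _).2 ((h x).1 hx)

theorem Syzygy.exact_incl (X : ChainComplex (ModuleCat.{u} R) ℕ) (j : ℕ) :
    Function.Exact (Syzygy.incl X j) (LinearMap.range (X.d (j + 1) j).hom).mkQ := by
  intro x
  rw [← LinearMap.mem_ker, Submodule.ker_mkQ]
  constructor
  · rintro ⟨y, rfl⟩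
    exact ⟨Submodule.Quotient.mk y, rfl⟩
  · rintro ⟨y, rfl⟩
    obtain ⟨y, rfl⟩ := Submodule.mkQ_surjective _ y
    exact ⟨y, rfl⟩

variable {D : ModuleCat.{u} R} {X : ChainComplex (ModuleCat.{u} R) ℕ}

/-- Dimension shifting along 0 → Syzygy (j+1) → X_j → Syzygy j → 0 with projective middle term. -/
theorem extZero_syzygy_iff (hP : ∀ j, Projective (X.X j)) (hX : ∀ j, X.ExactAt (j + 1))
    (i j : ℕ) : ExtZero D (i + 1) (Syzygy X j) ↔ ExtZero D 1 (Syzygy X (j + i)) := by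
  have hP' : ∀ j, Module.Projective R (X.X j) := fun j =>
    (IsProjective.iff_projective _).2 (hP j)
  induction i generalizing j with
  | zero => rfl
  | succ i ih =>
    rw [show j + (i + 1) = j + 1 + i by omega]
    refine Iff.trans ?_ (ih (j + 1))
    constructor
    · exact ExtZero.left (Syzygy.incl_injective (hX j)) (Syzygy.exact_incl X j)
        (Submodule.mkQ_surjective _) (extZero_of_projective i)
    · exact fun h => ExtZero.right (Syzygy.incl_injective (hX j)) (Syzygy.exact_incl X j)
        (Submodule.mkQ_surjective _) h (extZero_of_projective (i + 1))

/-- Maps out of the next syzygy are the maps out of X_(j+1) that kill boundaries. The right-hand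
side is thus exactness of Hom(X, D) at j + 1, in the form that character duality produces. -/
theorem extZero_one_syzygy_iff (hP : ∀ j, Projective (X.X j)) (hX : ∀ j, X.ExactAt (j + 1))
    (j : ℕ) : ExtZero D 1 (Syzygy X j) ↔
      ∀ φ : X.X (j + 1) →ₗ[R] D, φ ∘ₗ (X.d (j + 2) (j + 1)).hom = 0 →
        ∃ ψ : X.X j →ₗ[R] D, ψ ∘ₗ (X.d (j + 1) j).hom = φ := by
  have hP' : ∀ j, Module.Projective R (X.X j) := fun j =>
    (IsProjective.iff_projective _).2 (hP j)
  have h1 : ExtZero D 1 (Syzygy X j) ↔ Extends D (Syzygy.incl X j) :=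
    ⟨ExtZero.extends (Syzygy.incl_injective (hX j)) (Syzygy.exact_incl X j)
        (Submodule.mkQ_surjective _),
      ExtZero.of_extends (Syzygy.incl_injective (hX j)) (Syzygy.exact_incl X j)
        (Submodule.mkQ_surjective _) (extZero_of_projective 0)⟩
  rw [h1]
  constructor
  · intro h φ hφ
    obtain ⟨ψ, hψ⟩ := h ((LinearMap.range (X.d (j + 2) (j + 1)).hom).liftQ φ (by
      rintro _ ⟨x, rfl⟩
      exact DFunLike.congr_fun hφ x))
    exact ⟨ψ, LinearMap.ext fun x => DFunLike.congr_fun hψ (Submodule.Quotient.mk x)⟩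
  · intro h φ
    obtain ⟨ψ, hψ⟩ := h (φ ∘ₗ Submodule.mkQ _) (by
      ext x
      have : (LinearMap.range (X.d (j + 2) (j + 1)).hom).mkQ ((X.d (j + 2) (j + 1)).hom x) = 0 :=
        (Submodule.Quotient.mk_eq_zero _).2 ⟨x, rfl⟩
      simp only [LinearMap.comp_apply, this, map_zero, LinearMap.zero_apply])
    refine ⟨ψ, Submodule.linearMap_qext _ ?_⟩
    exact hψ

/-- A complex that is exact in positive degrees is quasi-isomorphic to its zeroth homology. -/
theorem exists_quasiIso_single {M : ModuleCat.{u} R} (hX : ∀ j, X.ExactAt (j + 1))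
    (π : X.X 0 ⟶ M) (hπ : Function.Surjective π.hom)
    (hdπ : Function.Exact (X.d 1 0).hom π.hom) :
    ∃ f : X ⟶ (ChainComplex.single₀ (ModuleCat.{u} R)).obj M, QuasiIso f := by
  have h0 : X.d 1 0 ≫ π = 0 := ModuleCat.hom_ext hdπ.linearMap_comp_eq_zero
  refine ⟨(ChainComplex.toSingle₀Equiv _ _).symm ⟨π, h0⟩, ⟨fun n => ?_⟩⟩
  cases n with
  | zero =>
    -- In degree 0 the condition is that X_1 → X_0 → M is exact with surjective last map.
    rw [ChainComplex.quasiIsoAt₀_iff, ShortComplex.quasiIso_iff_of_zeros']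
    · refine (ShortComplex.exact_and_epi_g_iff_of_iso (S₁ := ShortComplex.mk (X.d 1 0) π h0) ?_).1
        ⟨(ShortComplex.ShortExact.moduleCat_exact_iff_function_exact _).2 hdπ,
          (ModuleCat.epi_iff_surjective _).2 hπ⟩
      exact ShortComplex.isoMk (Iso.refl _) (Iso.refl _) (Iso.refl _)
        ((Category.id_comp _).trans (Category.comp_id _).symm)
        ((Category.id_comp _).trans (Category.comp_id _).symm)
    · exact X.shape 0 0 (by simp)
    all_goals rfl
  | succ n =>
    rw [quasiIsoAt_iff_exactAt']
    · exact hX n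
    · apply ChainComplex.exactAt_succ_single_obj

theorem nonempty_syzygy_zero_equiv (X : ChainComplex (ModuleCat.{u} R) ℕ) :
    Nonempty (ModuleCat.of R (Syzygy X 0) ≅ X.homology 0) := by
  have e1 := X.isoHomologyι₀
  have e2 := (X.opcyclesIsCokernel 1 0 (by simp)).coconePointUniqueUpToIso
    (Limits.cokernelIsCokernel (X.d 1 0))
  have e3 := ModuleCat.cokernelIsoRangeQuotient (X.d 1 0)
  exact ⟨(e1 ≪≫ e2 ≪≫ e3).symm⟩

end Complexes

/-! ### Purity as vanishing of Ext into character modules -/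

section Purity

variable {A : Type u} [Ring A]

/-- A zigzag provides no map from X to Y, but isomorphisms of homology in each degree are enough to
transport purity. -/
theorem QuasiIsomorphic.nonempty_homology_iso {X Y : ChainComplex (ModuleCat.{u} Aᵐᵒᵖ) ℕ}
    (h : QuasiIsomorphic X Y) (i : ℕ) : Nonempty (X.homology i ≅ Y.homology i) := by
  induction h with
  | rel X Y h =>
    obtain ⟨f, hf⟩ := h
    exact ⟨isoOfQuasiIsoAt f i⟩
  | refl X => exact ⟨Iso.refl _⟩
  | symm X Y _ ih => exact ih.map Iso.symm
  | trans X Y Z _ _ ih ih' =>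
    obtain ⟨e⟩ := ih
    obtain ⟨e'⟩ := ih'
    exact ⟨e ≪≫ e'⟩

theorem IsPure.of_quasiIsomorphic {X Y : ChainComplex (ModuleCat.{u} Aᵐᵒᵖ) ℕ}
    (h : QuasiIsomorphic X Y) (hX : IsPure X) : IsPure Y := fun i hi => by
  obtain ⟨e⟩ := h.nonempty_homology_iso i
  exact (hX i hi).of_iso e.symm

theorem isPure_iff (X : ChainComplex (ModuleCat.{u} Aᵐᵒᵖ) ℕ) :
    IsPure X ↔ ∀ j, X.ExactAt (j + 1) := by
  simp only [HomologicalComplex.exactAt_iff_isZero_homology]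
  constructor
  · exact fun h j => h _ (Nat.succ_ne_zero j)
  · intro h i hi
    obtain ⟨j, rfl⟩ := Nat.exists_eq_succ_of_ne_zero hi
    exact h j

theorem isPure_asComplex (M : ModuleCat.{u} Aᵐᵒᵖ) : IsPure (asComplex M) :=
  (isPure_iff _).2 fun j => ChainComplex.exactAt_succ_single_obj M j

/-- The complex `X ⊗ N`. -/
noncomputable abbrev tensorComplex (X : ChainComplex (ModuleCat.{u} Aᵐᵒᵖ) ℕ) (N : Bimodule A) :
    ChainComplex (ModuleCat.{u} Aᵐᵒᵖ) ℕ :=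
  ((tensorFunctor N).mapHomologicalComplex (ComplexShape.down ℕ)).obj X

/-- Shifting turns each Ext group into Ext^1 of a higher syzygy. Character duality then matches its
vanishing with exactness of X ⊗ N in a single degree. -/
theorem isPure_tensorComplex_iff {X : ChainComplex (ModuleCat.{u} Aᵐᵒᵖ) ℕ} {N : Bimodule A}
    (hP : ∀ j, Projective (X.X j)) (hX : IsPure X) :
    IsPure (tensorComplex X N) ↔ ∀ i, ExtZero (dualModule N) (i + 1) (Syzygy X 0) := by
  rw [isPure_iff] at hX ⊢
  refine forall_congr' fun j => ?_
  rw [extZero_syzygy_iff hP hX, Nat.zero_add, extZero_one_syzygy_iff hP hX, exactAt_succ_iff]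
  refine Tensor.exact_rTensor_iff ?_
  rw [← ModuleCat.hom_comp, X.d_comp_d]
  rfl

theorem nonempty_syzygy_iso_of_asComplex {X : ChainComplex (ModuleCat.{u} Aᵐᵒᵖ) ℕ}
    {M : ModuleCat.{u} Aᵐᵒᵖ} (h : QuasiIsomorphic X (asComplex M)) :
    Nonempty (Syzygy X 0 ≃ₗ[Aᵐᵒᵖ] M) := by
  obtain ⟨e⟩ := h.nonempty_homology_iso 0
  obtain ⟨e'⟩ := nonempty_syzygy_zero_equiv X
  exact ⟨(e' ≪≫ e ≪≫ HomologicalComplex.singleObjHomologySelfIso _ _ _).toLinearEquiv⟩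

theorem QuasiIsomorphic.symm {X Y : ChainComplex (ModuleCat.{u} Aᵐᵒᵖ) ℕ}
    (h : QuasiIsomorphic X Y) : QuasiIsomorphic Y X := Relation.EqvGen.symm _ _ h

/-- A projective resolution computing derived tensor products. -/
theorem exists_projective_resolution (M : ModuleCat.{u} Aᵐᵒᵖ) :
    ∃ P : ChainComplex (ModuleCat.{u} Aᵐᵒᵖ) ℕ, (∀ j, Projective (P.X j)) ∧
      QuasiIsomorphic P (asComplex M) :=
  let P := ProjectiveResolution.of M
  ⟨P.complex, P.projective, Relation.EqvGen.rel _ _ ⟨P.π, P.quasiIso⟩⟩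

/-- The Ext condition does not mention the resolution, so one projective resolution decides purity
for every representative of the derived tensor product. -/
theorem derivedTensorPure_iff (M : ModuleCat.{u} Aᵐᵒᵖ) (N : Bimodule A) :
    DerivedTensorPure M N ↔ ∀ i, ExtZero (dualModule N) (i + 1) M := by
  have key : ∀ P : ChainComplex (ModuleCat.{u} Aᵐᵒᵖ) ℕ, (∀ j, Projective (P.X j)) →
      QuasiIsomorphic P (asComplex M) →
      (IsPure (tensorComplex P N) ↔ ∀ i, ExtZero (dualModule N) (i + 1) M) := by
    intro P hP hPM
    obtain ⟨e⟩ := nonempty_syzygy_iso_of_asComplex hPM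
    rw [isPure_tensorComplex_iff hP (IsPure.of_quasiIsomorphic hPM.symm (isPure_asComplex M))]
    exact forall_congr' fun i => ⟨ExtZero.of_equiv e, ExtZero.of_equiv e.symm⟩
  constructor
  · intro h
    obtain ⟨P, hP, hPM⟩ := exists_projective_resolution M
    exact (key P hP hPM).1 (h _ ⟨P, hP, hPM, Relation.EqvGen.refl _⟩)
  · rintro h Y ⟨P, hP, hPM, hY⟩
    exact ((key P hP hPM).2 h).of_quasiIsomorphic hY

/-- If `P` resolves `M` and `P ⊗ N` is pure then it is quasi-isomorphic to `M ⊗ N`. -/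
theorem quasiIsomorphic_tensorComplex {P : ChainComplex (ModuleCat.{u} Aᵐᵒᵖ) ℕ}
    {M : ModuleCat.{u} Aᵐᵒᵖ} (hPM : QuasiIsomorphic P (asComplex M)) {N : Bimodule A}
    (h : IsPure (tensorComplex P N)) :
    QuasiIsomorphic (tensorComplex P N) (asComplex (ModuleCat.of Aᵐᵒᵖ (Tensor A M N))) := by
  obtain ⟨e⟩ := nonempty_syzygy_iso_of_asComplex hPM
  let π : P.X 0 →ₗ[Aᵐᵒᵖ] M := e.toLinearMap ∘ₗ (LinearMap.range (P.d 1 0).hom).mkQ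
  have hπ : Function.Surjective π := e.surjective.comp (Submodule.mkQ_surjective _)
  have hdπ : Function.Exact (P.d 1 0).hom π := by
    intro x
    change e _ = 0 ↔ _
    rw [map_eq_zero_iff _ e.injective]
    exact Submodule.Quotient.mk_eq_zero _
  obtain ⟨f, hf⟩ := exists_quasiIso_single (X := tensorComplex P N) ((isPure_iff _).1 h)
    (M := ModuleCat.of Aᵐᵒᵖ (Tensor A M N)) (ModuleCat.ofHom (Tensor.rTensor N π))
    (Tensor.rTensor_surjective hπ) (Tensor.exact_rTensor hdπ hπ)
  exact Relation.EqvGen.rel _ _ ⟨f, hf⟩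

/-- Purity at each stage allows the derived power to be replaced by the ordinary one before the next
tensoring. -/
theorem isDerivedPower_asComplex {σ : Bimodule A}
    (hσ : ∀ n : ℕ, 1 ≤ n → DerivedPowerPure σ n) (n : ℕ) :
    IsDerivedPower σ n (asComplex (ModuleCat.of Aᵐᵒᵖ (σ.pow n))) := by
  induction n with
  | zero => exact Relation.EqvGen.refl _
  | succ n ih =>
    obtain ⟨P, hP, hPM⟩ := exists_projective_resolution (ModuleCat.of Aᵐᵒᵖ (σ.pow n))
    have hpure : IsPure (tensorComplex P σ) := hσ (n + 1) (Nat.succ_pos n) _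
      ⟨_, ih, P, hP, hPM, Relation.EqvGen.refl _⟩
    exact ⟨_, ih, P, hP, hPM, quasiIsomorphic_tensorComplex hPM hpure⟩

/-- Purity of the derived powers of `σ` says that `Tor_i(σ^n, σ) = 0` for `i ≥ 1`. -/
theorem extZero_pow_of_derivedPowerPure {σ : Bimodule A}
    (hσ : ∀ n : ℕ, 1 ≤ n → DerivedPowerPure σ n) (n i : ℕ) :
    ExtZero (dualModule σ) (i + 1) (σ.pow n) :=
  (derivedTensorPure_iff (ModuleCat.of Aᵐᵒᵖ (σ.pow n)) σ).1
    (fun Y hY => hσ (n + 1) (Nat.succ_pos n) Y ⟨_, isDerivedPower_asComplex hσ n, hY⟩) i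

end Purity

end GrCoh

namespace GrCoh

/-! ## Associativity and unitality of the tensor product -/

namespace Tensor

section Assoc

variable {A : Type u} [Ring A]
variable {L M : Type u} [AddCommGroup L] [Module Aᵐᵒᵖ L] [AddCommGroup M] [Module Aᵐᵒᵖ M]
variable {N : Type u} [AddCommGroup N] [Module A N]

/-- The tensor product as a biadditive map. -/
def tmulHom (A : Type u) [Ring A] (M : Type u) [AddCommGroup M] [Module Aᵐᵒᵖ M]
    (N : Type u) [AddCommGroup N] [Module A N] : M →+ N →+ Tensor A M N :=
  AddMonoidHom.mk' (fun x => AddMonoidHom.mk' (fun y => tmul A x y) (tmul_add x))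
    fun x x' => AddMonoidHom.ext fun y => add_tmul x x' y

@[simp]
theorem tmulHom_apply (x : M) (y : N) : tmulHom A M N x y = tmul A x y := rfl

variable [Module Aᵐᵒᵖ N] [SMulCommClass A Aᵐᵒᵖ N]

/-- A balanced biadditive map that is right linear in the second variable induces a right linear
map on the tensor product. -/
def liftLinear {P : Type u} [AddCommGroup P] [Module Aᵐᵒᵖ P] (f : M →+ N →+ P)
    (hf : ∀ (x : M) (a : A) (y : N), f (op a • x) y = f x (a • y))
    (hs : ∀ (x : M) (b : Aᵐᵒᵖ) (y : N), f x (b • y) = b • f x y) : Tensor A M N →ₗ[Aᵐᵒᵖ] P where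
  toFun := lift f hf
  map_add' := map_add _
  map_smul' b t := DFunLike.congr_fun
    (f := (lift f hf).comp (DistribSMul.toAddMonoidHom (Tensor A M N) b))
    (g := (DistribSMul.toAddMonoidHom P b).comp (lift f hf)) (hom_ext fun x y => hs x b y) t

variable {N' : Type u} [AddCommGroup N'] [Module A N']

/-- The triadditive map `(x, y, z) ↦ x ⊗ (y ⊗ z)`. -/
def tmulTmulRight (A M N N' : Type u) [Ring A] [AddCommGroup M] [Module Aᵐᵒᵖ M] [AddCommGroup N]
    [Module A N] [Module Aᵐᵒᵖ N] [SMulCommClass A Aᵐᵒᵖ N] [AddCommGroup N'] [Module A N'] :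
    M →+ N →+ N' →+ Tensor A M (Tensor A N N') :=
  AddMonoidHom.mk' (fun x => AddMonoidHom.mk'
    (fun y => (tmulHom A M (Tensor A N N') x).comp (tmulHom A N N' y))
    fun y y' => by ext z; simp [tmul_add])
    fun x x' => by ext y z; simp

@[simp]
theorem tmulTmulRight_apply (x : M) (y : N) (z : N') :
    tmulTmulRight A M N N' x y z = tmul A x (tmul A y z) := rfl

/-- The triadditive map `(x, y, z) ↦ (x ⊗ y) ⊗ z`. -/
def tmulTmulLeft (A M N N' : Type u) [Ring A] [AddCommGroup M] [Module Aᵐᵒᵖ M] [AddCommGroup N]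
    [Module A N] [Module Aᵐᵒᵖ N] [SMulCommClass A Aᵐᵒᵖ N] [AddCommGroup N'] [Module A N'] :
    M →+ N →+ N' →+ Tensor A (Tensor A M N) N' :=
  AddMonoidHom.mk' (fun x => (tmulHom A (Tensor A M N) N').comp (tmulHom A M N x))
    fun x x' => by ext y z; simp

@[simp]
theorem tmulTmulLeft_apply (x : M) (y : N) (z : N') :
    tmulTmulLeft A M N N' x y z = tmul A (tmul A x y) z := rfl

/-- The biadditive map `(x ⊗ y, z) ↦ x ⊗ (y ⊗ z)`. -/
def assocLeftAux (A M N N' : Type u) [Ring A] [AddCommGroup M] [Module Aᵐᵒᵖ M] [AddCommGroup N]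
    [Module A N] [Module Aᵐᵒᵖ N] [SMulCommClass A Aᵐᵒᵖ N] [AddCommGroup N'] [Module A N'] :
    Tensor A M N →+ N' →+ Tensor A M (Tensor A N N') :=
  lift (tmulTmulRight A M N N') fun x a y => AddMonoidHom.ext fun z => smul_tmul a x (tmul A y z)

/-- For fixed `x`, the additive map `y ⊗ z ↦ (x ⊗ y) ⊗ z`. -/
def assocRightAux (N N' : Type u) [AddCommGroup N]
    [Module A N] [Module Aᵐᵒᵖ N] [SMulCommClass A Aᵐᵒᵖ N] [AddCommGroup N'] [Module A N'] (x : M) :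
    Tensor A N N' →+ Tensor A (Tensor A M N) N' :=
  lift (tmulTmulLeft A M N N' x) fun y a z => smul_tmul a (tmul A x y) z

@[simp]
theorem assocRightAux_tmul (x : M) (y : N) (z : N') :
    assocRightAux N N' x (tmul A y z) = tmul A (tmul A x y) z := rfl

/-- The map `M ⊗ (N ⊗ N') → (M ⊗ N) ⊗ N'`. -/
def assocInv (A M N N' : Type u) [Ring A] [AddCommGroup M] [Module Aᵐᵒᵖ M] [AddCommGroup N]
    [Module A N] [Module Aᵐᵒᵖ N] [SMulCommClass A Aᵐᵒᵖ N] [AddCommGroup N'] [Module A N'] :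
    Tensor A M (Tensor A N N') →+ Tensor A (Tensor A M N) N' :=
  lift (AddMonoidHom.mk' (assocRightAux N N') fun x x' => hom_ext fun y z => by simp [add_tmul])
    fun x a t => DFunLike.congr_fun (f := assocRightAux N N' (op a • x))
      (g := (assocRightAux N N' x).comp (DistribSMul.toAddMonoidHom (Tensor A N N') a))
      (hom_ext fun y z => congrArg (fun u => tmul A u z) (smul_tmul a x y)) t

theorem hom_ext₂ {P : Type u} [AddCommGroup P] {f g : Tensor A (Tensor A M N) N' →+ P}
    (h : ∀ x y z, f (tmul A (tmul A x y) z) = g (tmul A (tmul A x y) z)) : f = g :=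
  hom_ext fun t z => DFunLike.congr_fun (f := f.comp ((tmulHom A (Tensor A M N) N').flip z))
    (g := g.comp ((tmulHom A (Tensor A M N) N').flip z)) (hom_ext fun x y => h x y z) t

theorem hom_ext₂' {P : Type u} [AddCommGroup P] {f g : Tensor A M (Tensor A N N') →+ P}
    (h : ∀ x y z, f (tmul A x (tmul A y z)) = g (tmul A x (tmul A y z))) : f = g :=
  hom_ext fun x t => DFunLike.congr_fun (f := f.comp (tmulHom A M (Tensor A N N') x))
    (g := g.comp (tmulHom A M (Tensor A N N') x)) (hom_ext fun y z => h x y z) t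

variable [Module Aᵐᵒᵖ N'] [SMulCommClass A Aᵐᵒᵖ N']

/-- The map `(M ⊗ N) ⊗ N' → M ⊗ (N ⊗ N')`. -/
def assocHom (A M N N' : Type u) [Ring A] [AddCommGroup M] [Module Aᵐᵒᵖ M] [AddCommGroup N]
    [Module A N] [Module Aᵐᵒᵖ N] [SMulCommClass A Aᵐᵒᵖ N] [AddCommGroup N'] [Module A N']
    [Module Aᵐᵒᵖ N'] [SMulCommClass A Aᵐᵒᵖ N'] :
    Tensor A (Tensor A M N) N' →ₗ[Aᵐᵒᵖ] Tensor A M (Tensor A N N') :=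
  liftLinear (assocLeftAux A M N N')
    (fun t a z => DFunLike.congr_fun
      (f := ((assocLeftAux A M N N').flip z).comp
        (DistribSMul.toAddMonoidHom (Tensor A M N) (op a)))
      (g := (assocLeftAux A M N N').flip (a • z))
      (hom_ext fun x y => congrArg (tmul A x) (smul_tmul a y z)) t)
    (fun t b z => DFunLike.congr_fun
      (f := (assocLeftAux A M N N').flip (b • z))
      (g := (DistribSMul.toAddMonoidHom (Tensor A M (Tensor A N N')) b).comp
        ((assocLeftAux A M N N').flip z))
      (hom_ext fun _ _ => rfl) t)

/-- Associativity of the tensor product. -/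
def assoc (A M N N' : Type u) [Ring A] [AddCommGroup M] [Module Aᵐᵒᵖ M] [AddCommGroup N]
    [Module A N] [Module Aᵐᵒᵖ N] [SMulCommClass A Aᵐᵒᵖ N] [AddCommGroup N'] [Module A N']
    [Module Aᵐᵒᵖ N'] [SMulCommClass A Aᵐᵒᵖ N'] :
    Tensor A (Tensor A M N) N' ≃ₗ[Aᵐᵒᵖ] Tensor A M (Tensor A N N') where
  __ := assocHom A M N N'
  invFun := assocInv A M N N'
  left_inv := DFunLike.congr_fun
    (f := (assocInv A M N N').comp (assocHom A M N N').toAddMonoidHom)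
    (g := AddMonoidHom.id _) (hom_ext₂ fun _ _ _ => rfl)
  right_inv := DFunLike.congr_fun
    (f := (assocHom A M N N').toAddMonoidHom.comp (assocInv A M N N'))
    (g := AddMonoidHom.id _) (hom_ext₂' fun _ _ _ => rfl)

/-- Associativity is natural in the first variable, so tensoring with N ⊗ N' can be done in two
stages. -/
theorem rTensor_tensor_injective {f : L →ₗ[Aᵐᵒᵖ] M}
    (h : Function.Injective (rTensor N' (rTensor N f))) :
    Function.Injective (rTensor (Tensor A N N') f) := by
  have key : ∀ t, assoc A M N N' (rTensor N' (rTensor N f) t) =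
      rTensor (Tensor A N N') f (assoc A L N N' t) := DFunLike.congr_fun
    (f := (assoc A M N N').toLinearMap.toAddMonoidHom.comp
      (rTensor N' (rTensor N f)).toAddMonoidHom)
    (g := (rTensor (Tensor A N N') f).toAddMonoidHom.comp
      (assoc A L N N').toLinearMap.toAddMonoidHom) (hom_ext₂ fun _ _ _ => rfl)
  intro s t hst
  obtain ⟨s, rfl⟩ := (assoc A L N N').surjective s
  obtain ⟨t, rfl⟩ := (assoc A L N N').surjective t
  rw [← key, ← key] at hst
  rw [h ((assoc A M N N').injective hst)]

/-- The unit isomorphism `A ⊗ N ≃ N`. -/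
def lid (A N : Type u) [Ring A] [AddCommGroup N] [Module A N] [Module Aᵐᵒᵖ N]
    [SMulCommClass A Aᵐᵒᵖ N] : Tensor A A N ≃ₗ[Aᵐᵒᵖ] N where
  __ := liftLinear (smulAddHom A N) (fun a b y => mul_smul a b y)
    fun a b y => smul_comm a b y
  invFun y := tmul A (1 : A) y
  left_inv := DFunLike.congr_fun
    (f := (tmulHom A A N 1).comp (liftLinear (smulAddHom A N)
      (fun a b y => mul_smul a b y) fun a b y => smul_comm a b y).toAddMonoidHom)
    (g := AddMonoidHom.id _) (hom_ext fun a y => by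
      change tmul A (1 : A) (a • y) = tmul A a y
      rw [← smul_tmul]
      simp)
  right_inv y := one_smul A y

/-- The biadditive map `(x, a) ↦ x a`. -/
def smulHom (A M : Type u) [Ring A] [AddCommGroup M] [Module Aᵐᵒᵖ M] : M →+ A →+ M :=
  ((smulAddHom Aᵐᵒᵖ M).comp (opAddEquiv : A ≃+ Aᵐᵒᵖ).toAddMonoidHom).flip

/-- Right multiplication as a map `M ⊗ A → M`. -/
def ridHom (A M : Type u) [Ring A] [AddCommGroup M] [Module Aᵐᵒᵖ M] : Tensor A M A →ₗ[Aᵐᵒᵖ] M :=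
  liftLinear (smulHom A M)
    (fun x a b => by
      change op b • op a • x = op (a * b) • x
      rw [op_mul, mul_smul])
    (fun x b a => by
      change op (a * unop b) • x = b • op a • x
      rw [op_mul, mul_smul, op_unop])

/-- The unit isomorphism `M ⊗ A ≃ M`. -/
def rid (A M : Type u) [Ring A] [AddCommGroup M] [Module Aᵐᵒᵖ M] : Tensor A M A ≃ₗ[Aᵐᵒᵖ] M where
  __ := ridHom A M
  invFun x := tmul A x (1 : A)
  left_inv := DFunLike.congr_fun
    (f := ((tmulHom A M A).flip 1).comp (ridHom A M).toAddMonoidHom)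
    (g := AddMonoidHom.id _) (hom_ext fun x a => by
      change tmul A (op a • x) (1 : A) = tmul A x a
      rw [smul_tmul]
      simp)
  right_inv x := one_smul _ x

theorem rTensor_zero : rTensor N (0 : L →ₗ[Aᵐᵒᵖ] M) = 0 :=
  right_hom_ext fun _ _ => by simp [zero_tmul]

theorem rTensor_sum {ι : Type*} (s : Finset ι) (f : ι → L →ₗ[Aᵐᵒᵖ] M) :
    rTensor N (∑ i ∈ s, f i) = ∑ i ∈ s, rTensor N (f i) :=
  map_sum (AddMonoidHom.mk' (fun f : L →ₗ[Aᵐᵒᵖ] M => rTensor N f) fun f g => rTensor_add f g) f s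

/-- The tensor product commutes with finite powers. -/
def piEquiv (r : ℕ) (M N : Type u) [AddCommGroup M] [Module Aᵐᵒᵖ M] [AddCommGroup N]
    [Module A N] [Module Aᵐᵒᵖ N] [SMulCommClass A Aᵐᵒᵖ N] :
    Tensor A (Fin r → M) N ≃ₗ[Aᵐᵒᵖ] (Fin r → Tensor A M N) :=
  LinearEquiv.ofLinearMap (LinearMap.pi fun i => rTensor N (LinearMap.proj i))
    (∑ i, rTensor N (LinearMap.single Aᵐᵒᵖ (fun _ => M) i) ∘ₗ LinearMap.proj i)
    (by
      refine LinearMap.ext fun t => funext fun i => ?_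
      have key : ∀ j, rTensor N (LinearMap.proj i)
          (rTensor N (LinearMap.single Aᵐᵒᵖ (fun _ : Fin r => M) j) (t j)) =
            if j = i then t i else 0 := by
        intro j
        rw [← LinearMap.comp_apply, ← rTensor_comp]
        split_ifs with h
        · subst h
          rw [LinearMap.proj_comp_single_same, rTensor_id, LinearMap.id_apply]
        · rw [LinearMap.proj_comp_single_ne _ _ _ _ (Ne.symm h), rTensor_zero,
            LinearMap.zero_apply]
      simp [key])
    (by
      refine LinearMap.ext fun t => ?_
      simp only [LinearMap.comp_apply, LinearMap.sum_apply, LinearMap.proj_apply,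
        LinearMap.pi_apply, LinearMap.id_apply]
      simp only [← LinearMap.comp_apply, ← rTensor_comp, ← LinearMap.sum_apply, ← rTensor_sum]
      have : ∑ i, LinearMap.single Aᵐᵒᵖ (fun _ : Fin r => M) i ∘ₗ LinearMap.proj i =
          LinearMap.id := LinearMap.ext fun x => by
        simp [LinearMap.sum_apply, Finset.univ_sum_single]
      rw [this, rTensor_id, LinearMap.id_apply])

/-- `A^r ⊗ N ≃ N^r`. -/
def freeEquiv (A : Type u) [Ring A] (r : ℕ) (N : Type u) [AddCommGroup N] [Module A N]
    [Module Aᵐᵒᵖ N] [SMulCommClass A Aᵐᵒᵖ N] : Tensor A (Fin r → A) N ≃ₗ[Aᵐᵒᵖ] (Fin r → N) :=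
  piEquiv r A N ≪≫ₗ LinearEquiv.piCongrRight fun _ => lid A N

end Assoc

end Tensor

/-- Powers are nested to the left, so the factors of the second power are moved across one at a
time. A right linear isomorphism suffices, since it is only used to transport vanishing of Ext. -/
theorem nonempty_tensor_pow_equiv {A : Type u} [Ring A] (σ : Bimodule A) (n k : ℕ) :
    Nonempty (Tensor A (σ.pow n) (σ.pow k) ≃ₗ[Aᵐᵒᵖ] σ.pow (n + k)) := by
  induction k with
  | zero => exact ⟨Tensor.rid A (σ.pow n)⟩
  | succ k ih =>
    obtain ⟨e⟩ := ih
    exact ⟨(Tensor.assoc A (σ.pow n) (σ.pow k) σ).symm ≪≫ₗ Tensor.rTensorEquiv σ e⟩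

end GrCoh

namespace GrCoh

/-! ## Finitely presented modules over a right coherent ring -/

section Coherent

variable {A : Type u} [Ring A]

/-- A ring is free of rank one as a right module over itself. -/
def opEquiv (A : Type u) [Ring A] : A ≃ₗ[Aᵐᵒᵖ] Aᵐᵒᵖ where
  toFun := op
  map_add' := op_add
  map_smul' a b := op_mul b (unop a)
  invFun := unop
  left_inv _ := rfl
  right_inv _ := rfl

instance : Module.FinitePresentation Aᵐᵒᵖ A := Module.FinitePresentation.of_equiv (opEquiv A).symm

instance : Module.Projective Aᵐᵒᵖ A := Module.Projective.of_equiv (opEquiv A).symm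

instance (r : ℕ) : Module.Projective Aᵐᵒᵖ (Fin r → A) :=
  Module.Projective.of_equiv (LinearEquiv.piCongrRight fun _ : Fin r => opEquiv A).symm

theorem exists_free_surjective (M : Type u) [AddCommGroup M] [Module Aᵐᵒᵖ M]
    [Module.Finite Aᵐᵒᵖ M] :
    ∃ (r : ℕ) (p : (Fin r → A) →ₗ[Aᵐᵒᵖ] M), Function.Surjective p := by
  obtain ⟨r, p, hp⟩ := Module.Finite.exists_fin' Aᵐᵒᵖ M
  exact ⟨r, p ∘ₗ (LinearEquiv.piCongrRight fun _ : Fin r => opEquiv A).toLinearMap,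
    hp.comp (LinearEquiv.surjective _)⟩

theorem exists_free_range_eq {M : Type u} [AddCommGroup M] [Module Aᵐᵒᵖ M]
    {K : Submodule Aᵐᵒᵖ M} (hK : K.FG) :
    ∃ (s : ℕ) (q : (Fin s → A) →ₗ[Aᵐᵒᵖ] M), LinearMap.range q = K := by
  have : Module.Finite Aᵐᵒᵖ K := Module.Finite.iff_fg.2 hK
  obtain ⟨s, q, hq⟩ := exists_free_surjective (A := A) K
  refine ⟨s, K.subtype ∘ₗ q, ?_⟩
  rw [LinearMap.range_comp, LinearMap.range_eq_top.2 hq, Submodule.map_top, Submodule.range_subtype]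

/-- Kernels of maps between finitely generated free modules are finitely generated. -/
theorem IsRightCoherent.ker_fg_of_free (hA : IsRightCoherent A) (r k : ℕ)
    (f : (Fin k → A) →ₗ[Aᵐᵒᵖ] (Fin r → A)) : (LinearMap.ker f).FG := by
  induction r generalizing k with
  | zero =>
    rw [Subsingleton.elim f 0, LinearMap.ker_zero]
    exact Module.Finite.fg_top
  | succ r ih =>
    -- The kernel of the coordinates other than 0 is covered by a free module via `q`. Coherence of
    -- A then applies to coordinate 0 alone.
    obtain ⟨s, q, hq⟩ := exists_free_range_eq (ih k (LinearMap.funLeft Aᵐᵒᵖ A Fin.succ ∘ₗ f))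
    have h := (hA.2 s (LinearMap.proj 0 ∘ₗ f ∘ₗ q)).map q
    suffices e : LinearMap.ker f = (LinearMap.ker (LinearMap.proj 0 ∘ₗ f ∘ₗ q)).map q by rwa [e]
    ext x
    simp only [LinearMap.mem_ker, Submodule.mem_map, LinearMap.comp_apply]
    constructor
    · intro hx
      have hx' : x ∈ LinearMap.range q := by
        rw [hq, LinearMap.mem_ker, LinearMap.comp_apply, hx, map_zero]
      obtain ⟨y, rfl⟩ := hx'
      exact ⟨y, by rw [hx]; rfl, rfl⟩
    · rintro ⟨y, hy, rfl⟩
      have hy' : q y ∈ LinearMap.range q := ⟨y, rfl⟩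
      rw [hq, LinearMap.mem_ker] at hy'
      exact funext fun i => Fin.cases hy (fun j => congrFun hy' j) i

variable {L M : Type u} [AddCommGroup L] [Module Aᵐᵒᵖ L] [AddCommGroup M] [Module Aᵐᵒᵖ M]

/-- Kernels of maps from finitely generated to finitely presented modules are finitely
generated. -/
theorem IsRightCoherent.ker_fg (hA : IsRightCoherent A) [Module.Finite Aᵐᵒᵖ L]
    [Module.FinitePresentation Aᵐᵒᵖ M] (f : L →ₗ[Aᵐᵒᵖ] M) : (LinearMap.ker f).FG := by
  obtain ⟨k, c, hc⟩ := exists_free_surjective (A := A) L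
  obtain ⟨r, p, hp⟩ := exists_free_surjective (A := A) M
  obtain ⟨s, q, hq⟩ := exists_free_range_eq (Module.FinitePresentation.fg_ker p hp)
  obtain ⟨g, hg⟩ := Module.projective_lifting_property p (f ∘ₗ c) hp
  let e : (Fin (k + s) → A) ≃ₗ[Aᵐᵒᵖ] (Fin k → A) × (Fin s → A) :=
    (LinearEquiv.funCongrLeft Aᵐᵒᵖ A finSumFinEquiv) ≪≫ₗ
      LinearEquiv.sumArrowLequivProdArrow (Fin k) (Fin s) Aᵐᵒᵖ A
  -- The pairs (y, z) with `g y = q z` form a kernel between free modules. As the range of `q` is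
  -- the kernel of `p`, the map `c` carries their first components onto the kernel of `f`.
  have h := (hA.ker_fg_of_free r (k + s)
    ((g ∘ₗ LinearMap.fst Aᵐᵒᵖ _ _ - q ∘ₗ LinearMap.snd Aᵐᵒᵖ _ _) ∘ₗ e.toLinearMap)).map
    (c ∘ₗ LinearMap.fst Aᵐᵒᵖ _ _ ∘ₗ e.toLinearMap)
  convert h using 1
  have hpg : ∀ x, p (g x) = f (c x) := DFunLike.congr_fun hg
  have hpq : ∀ x, p (q x) = 0 := fun x => by
    have : q x ∈ LinearMap.range q := ⟨x, rfl⟩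
    rwa [hq] at this
  ext x
  simp only [LinearMap.mem_ker, Submodule.mem_map]
  constructor
  · intro hx
    obtain ⟨y, rfl⟩ := hc x
    have hy : g y ∈ LinearMap.range q := by rw [hq, LinearMap.mem_ker, hpg, hx]
    obtain ⟨z, hz⟩ := hy
    refine ⟨e.symm (y, z), ?_, ?_⟩ <;> simp [hz]
  · rintro ⟨y, hy, rfl⟩
    have hy' : g (e y).1 = q (e y).2 := sub_eq_zero.1 hy
    change f (c (e y).1) = 0
    rw [← hpg, hy', hpq]

/-- Finitely generated submodules of finitely presented modules are finitely presented. -/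
theorem IsRightCoherent.finitePresentation (hA : IsRightCoherent A)
    [Module.FinitePresentation Aᵐᵒᵖ M] {K : Submodule Aᵐᵒᵖ M} (hK : K.FG) :
    Module.FinitePresentation Aᵐᵒᵖ K := by
  have : Module.Finite Aᵐᵒᵖ K := Module.Finite.iff_fg.2 hK
  obtain ⟨s, q, hq⟩ := exists_free_surjective (A := A) K
  refine Module.finitePresentation_of_surjective q hq ?_
  have h := hA.ker_fg (K.subtype ∘ₗ q)
  rwa [LinearMap.ker_comp_of_ker_eq_bot _ K.ker_subtype] at h

theorem finitePresentation_quotient [Module.FinitePresentation Aᵐᵒᵖ M] {K : Submodule Aᵐᵒᵖ M}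
    (hK : K.FG) : Module.FinitePresentation Aᵐᵒᵖ (M ⧸ K) :=
  Module.finitePresentation_of_surjective K.mkQ (Submodule.mkQ_surjective K)
    (by rwa [Submodule.ker_mkQ])

/-- The tensor product of finitely presented modules is finitely presented. -/
theorem finitePresentation_tensor [Module.FinitePresentation Aᵐᵒᵖ M] (N : Bimodule A)
    [Module.FinitePresentation Aᵐᵒᵖ N] : Module.FinitePresentation Aᵐᵒᵖ (Tensor A M N) := by
  obtain ⟨r, p, hp⟩ := exists_free_surjective (A := A) M
  obtain ⟨s, q, hq⟩ := exists_free_range_eq (Module.FinitePresentation.fg_ker p hp)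
  have hqp : Function.Exact q p := LinearMap.exact_iff.2 hq.symm
  have := Module.FinitePresentation.of_equiv (Tensor.freeEquiv A r N).symm
  have := Module.FinitePresentation.of_equiv (Tensor.freeEquiv A s N).symm
  refine Module.finitePresentation_of_surjective (Tensor.rTensor N p)
    (Tensor.rTensor_surjective hp) ?_
  rw [LinearMap.exact_iff.1 (Tensor.exact_rTensor hqp hp), LinearMap.range_eq_map]
  exact Module.Finite.fg_top.map _

theorem finitePresentation_pow (σ : Bimodule A) (hσ : Module.FinitePresentation Aᵐᵒᵖ σ) (n : ℕ) :
    Module.FinitePresentation Aᵐᵒᵖ (σ.pow n) := by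
  induction n with
  | zero => exact inferInstanceAs (Module.FinitePresentation Aᵐᵒᵖ A)
  | succ n ih => exact finitePresentation_tensor (M := σ.pow n) σ

end Coherent

/-! ## Vanishing of `Tor` between tensor powers -/

section TensorPowers

variable {A : Type u} [Ring A]

theorem Tensor.rTensor_unit_injective {L M : Type u} [AddCommGroup L] [Module Aᵐᵒᵖ L]
    [AddCommGroup M] [Module Aᵐᵒᵖ M] {f : L →ₗ[Aᵐᵒᵖ] M} (hf : Function.Injective f) :
    Function.Injective (Tensor.rTensor A f) := by
  have key : ∀ t, Tensor.rid A M (Tensor.rTensor A f t) = f (Tensor.rid A L t) :=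
    DFunLike.congr_fun
      (f := (Tensor.rid A M).toLinearMap.toAddMonoidHom.comp (Tensor.rTensor A f).toAddMonoidHom)
      (g := f.toAddMonoidHom.comp (Tensor.rid A L).toLinearMap.toAddMonoidHom)
      (Tensor.hom_ext fun x a => (map_smul f (op a) x).symm)
  intro s t hst
  apply (Tensor.rid A L).injective
  apply hf
  rw [← key, ← key, hst]

/-- Flatness of A, from M ⊗ A = M and dimension shifting. The free cover is on all elements of M,
since M need not be finitely generated. -/
theorem extZero_pow_zero (σ : Bimodule A) (i : ℕ) (M : Type u) [AddCommGroup M]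
    [Module Aᵐᵒᵖ M] : ExtZero (dualModule (σ.pow 0)) (i + 1) M := by
  have hp := Finsupp.linearCombination_id_surjective Aᵐᵒᵖ M
  induction i generalizing M with
  | zero =>
    exact ExtZero.of_extends (Submodule.injective_subtype _)
      (LinearMap.exact_subtype_ker_map _) hp (extZero_of_projective 0)
      (Tensor.rTensor_injective_iff.1
        (Tensor.rTensor_unit_injective (Submodule.injective_subtype _)))
  | succ i ih =>
    exact ExtZero.right (Submodule.injective_subtype _)
      (LinearMap.exact_subtype_ker_map _) hp
      (ih _ (Finsupp.linearCombination_id_surjective Aᵐᵒᵖ _)) (extZero_of_projective (i + 1))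

/-- If `Tor_i(M, N) = 0` for `i ≥ 1` and `P → M` is a map with kernel `Z`, then
`Z ⊗ N → P ⊗ N` is injective. -/
theorem ExtZero.rTensor_injective {N : Bimodule A} {K L M : Type u} [AddCommGroup K]
    [Module Aᵐᵒᵖ K] [AddCommGroup L] [Module Aᵐᵒᵖ L] [AddCommGroup M] [Module Aᵐᵒᵖ M]
    {f : K →ₗ[Aᵐᵒᵖ] L} {g : L →ₗ[Aᵐᵒᵖ] M} (hf : Function.Injective f)
    (hfg : Function.Exact f g) (hg : Function.Surjective g)
    (hM : ExtZero (dualModule N) 1 M) : Function.Injective (Tensor.rTensor N f) :=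
  Tensor.rTensor_injective_iff.2 (ExtZero.extends hf hfg hg hM)

/-- The tensor product of two bimodules. -/
abbrev Bimodule.tensor (N N' : Bimodule A) : Bimodule A := ⟨Tensor A N N'⟩

/-- Let Z be the kernel of a finite free cover A^r → M. Then Z ⊗ N ⊗ N' → A^r ⊗ N ⊗ N' is injective
in two stages, by Tor_1(M, N) = 0 and Tor_1(M ⊗ N, N') = 0. For higher Tor, pass to Z: coherence
keeps it finitely presented, and it inherits the hypotheses because 0 → Z ⊗ N → N^r → M ⊗ N → 0 is
exact and N has no higher Tor with N'. -/
theorem extZero_tensor (hA : IsRightCoherent A) {N N' : Bimodule A}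
    (hN : ∀ i, ExtZero (dualModule N') (i + 1) N) {M : Type u} [AddCommGroup M] [Module Aᵐᵒᵖ M]
    [Module.FinitePresentation Aᵐᵒᵖ M] (hM : ∀ i, ExtZero (dualModule N) (i + 1) M)
    (hMN : ∀ i, ExtZero (dualModule N') (i + 1) (Tensor A M N)) (i : ℕ) :
    ExtZero (dualModule (N.tensor N')) (i + 1) M := by
  induction i generalizing M with
  | zero =>
    obtain ⟨r, p, hp⟩ := exists_free_surjective (A := A) M
    have hi := Submodule.injective_subtype (LinearMap.ker p)
    have he := LinearMap.exact_subtype_ker_map p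
    refine ExtZero.of_extends hi he hp (extZero_of_projective 0)
      (Tensor.rTensor_injective_iff.1 (Tensor.rTensor_tensor_injective ?_))
    exact ExtZero.rTensor_injective (ExtZero.rTensor_injective hi he hp (hM 0))
      (Tensor.exact_rTensor he hp) (Tensor.rTensor_surjective hp) (hMN 0)
  | succ i ih =>
    obtain ⟨r, p, hp⟩ := exists_free_surjective (A := A) M
    have hi := Submodule.injective_subtype (LinearMap.ker p)
    have he := LinearMap.exact_subtype_ker_map p
    have := hA.finitePresentation (Module.FinitePresentation.fg_ker p hp)
    refine ExtZero.right hi he hp (ih (fun j => ?_) fun j => ?_) (extZero_of_projective (i + 1))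
    · exact ExtZero.left hi he hp (extZero_of_projective j) (hM (j + 1))
    · exact ExtZero.left (ExtZero.rTensor_injective hi he hp (hM 0))
        (Tensor.exact_rTensor he hp) (Tensor.rTensor_surjective hp)
        (ExtZero.of_equiv (Tensor.freeEquiv A r N).symm ((hN j).pi r)) (hMN (j + 1))

/-- `Tor_i(σ^n, σ^k) = 0` for `i ≥ 1`. -/
theorem extZero_pow_pow (hA : IsRightCoherent A) {σ : Bimodule A}
    (hσfp : Module.FinitePresentation Aᵐᵒᵖ σ)
    (hσ : ∀ n : ℕ, 1 ≤ n → DerivedPowerPure σ n) (n k i : ℕ) :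
    ExtZero (dualModule (σ.pow k)) (i + 1) (σ.pow n) := by
  induction k generalizing n i with
  | zero => exact extZero_pow_zero σ i _
  | succ k ih =>
    have := finitePresentation_pow σ hσfp n
    refine extZero_tensor hA (N := σ.pow k) (N' := σ)
      (fun i => extZero_pow_of_derivedPowerPure hσ k i) (ih n) (fun i => ?_) i
    obtain ⟨e⟩ := nonempty_tensor_pow_equiv σ n k
    exact (extZero_pow_of_derivedPowerPure hσ (n + k) i).of_equiv e.symm

end TensorPowers

end GrCoh

namespace GrCoh

/-! ## The tensor algebra as a graded ring -/

section TensorAlgebra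

variable {A : Type u} [Ring A]

namespace Bimodule

variable (σ : Bimodule A)

/-- The inclusion of `σ^n` in the tensor algebra. -/
def incl (n : ℕ) : (σ.pow n : Type u) →ₗ[Aᵐᵒᵖ] σ.TensorAlg :=
  DirectSum.lof Aᵐᵒᵖ ℕ (fun n => (σ.pow n).carrier) n

/-- An element of `A` as an element of `σ^0`. -/
def ofBase (a : A) : σ.pow 0 := a

variable {σ} in
/-- The element `y ⊗ s` of `σ^(n+1)`. -/
def snoc {n : ℕ} (y : σ.pow n) (s : σ) : σ.pow (n + 1) := Tensor.tmul A y s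

/-- The inclusion of `A` in the tensor algebra. -/
def scalar (a : A) : σ.TensorAlg := σ.incl 0 (σ.ofBase a)

/-- The inclusion of `σ` in the tensor algebra. -/
def inclOne (s : σ) : σ.TensorAlg := σ.incl 1 (snoc (σ.ofBase 1) s)

variable {σ}

theorem incl_eq_of (n : ℕ) (y : σ.pow n) :
    σ.incl n y = DirectSum.of (fun n => (σ.pow n).carrier) n y := rfl

theorem incl_mul_incl {m n : ℕ} (x : σ.pow m) (y : σ.pow n) :
    σ.incl m x * σ.incl n y = σ.incl (m + n) (σ.leftMul x n y) := by
  simp only [incl_eq_of]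
  exact DirectSum.of_mul_of (A := fun n => (σ.pow n).carrier) x y

/-- Splitting off the last factor as a product is what drives the inductions on degree. -/
theorem incl_snoc {n : ℕ} (y : σ.pow n) (s : σ) :
    σ.incl (n + 1) (snoc y s) = σ.incl n y * σ.inclOne s := by
  rw [inclOne, incl_mul_incl]
  have h : y = σ.leftMul y 0 (σ.ofBase 1) := (one_smul Aᵐᵒᵖ y).symm
  exact congrArg (fun x => σ.incl (n + 1) (snoc x s)) h

theorem scalar_one : σ.scalar 1 = 1 := rfl

theorem scalar_add (a b : A) : σ.scalar (a + b) = σ.scalar a + σ.scalar b :=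
  map_add (σ.incl 0) (σ.ofBase a) (σ.ofBase b)

theorem incl_op_smul {n : ℕ} (y : σ.pow n) (a : A) :
    σ.incl n (op a • y) = σ.incl n y * σ.scalar a := by
  rw [scalar, incl_mul_incl]
  rfl

theorem scalar_mul (a b : A) : σ.scalar (a * b) = σ.scalar a * σ.scalar b :=
  incl_op_smul (σ.ofBase a) b

theorem op_smul_eq_mul (a : A) (t : σ.TensorAlg) : op a • t = t * σ.scalar a := by
  refine DFunLike.congr_fun (f := DistribSMul.toAddMonoidHom σ.TensorAlg (op a))
    (g := AddMonoidHom.mulRight (σ.scalar a)) (DirectSum.addHom_ext fun n y => ?_) t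
  change op a • σ.incl n y = σ.incl n y * σ.scalar a
  rw [← incl_op_smul, map_smul]

theorem pow_succ_induction {n : ℕ} {p : σ.pow (n + 1) → Prop} (h0 : p 0)
    (ht : ∀ (y : σ.pow n) (s : σ), p (snoc y s))
    (ha : ∀ s t, p s → p t → p (s + t)) (t : σ.pow (n + 1)) : p t :=
  Tensor.induction (M := σ.pow n) (N := σ) h0 ht ha t

theorem smul_snoc {n : ℕ} (a : A) (y : σ.pow n) (s : σ) : a • snoc y s = snoc (a • y) s := rfl

theorem scalar_mul_incl {n : ℕ} (a : A) (y : σ.pow n) :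
    σ.scalar a * σ.incl n y = σ.incl n (a • y) := by
  induction n with
  | zero => exact (scalar_mul a y).symm
  | succ n ih =>
    induction y using pow_succ_induction with
    | h0 => simp
    | ht y s => rw [incl_snoc, ← mul_assoc, ih, ← incl_snoc, smul_snoc]
    | ha s t hs ht => rw [map_add, mul_add, hs, ht, smul_add, map_add]

/-- Elements of σ^(m+n) are sums of products from σ^m and σ^n. The predicate lives on the whole
algebra and varies in the induction, so that a last factor `s` can be absorbed by passing to t ↦ p
(t s). -/
theorem mul_induction {m n : ℕ} {p : σ.TensorAlg → Prop} (h0 : p 0)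
    (ha : ∀ s t, p s → p t → p (s + t))
    (hm : ∀ (u : σ.pow m) (v : σ.pow n), p (σ.incl m u * σ.incl n v)) (z : σ.pow (m + n)) :
    p (σ.incl (m + n) z) := by
  induction n generalizing p with
  | zero =>
    have h := hm z (σ.ofBase 1)
    rw [← scalar, scalar_one, mul_one] at h
    exact h
  | succ n ih =>
    change σ.pow (m + n + 1) at z
    change p (σ.incl (m + n + 1) z)
    induction z using pow_succ_induction with
    | h0 => rwa [map_zero]
    | ht y s =>
      rw [incl_snoc]
      refine ih (p := fun t => p (t * σ.inclOne s)) (by rwa [zero_mul])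
        (fun s t hs ht => by rw [add_mul]; exact ha _ _ hs ht) (fun u v => ?_) y
      rw [mul_assoc, ← incl_snoc]
      exact hm u _
    | ha s t hs ht => rw [map_add]; exact ha _ _ hs ht

theorem grading_of_neg {n : ℤ} (hn : n < 0) : σ.grading n = ⊥ := by
  obtain ⟨m, rfl⟩ := Int.eq_negSucc_of_lt_zero hn
  rfl

theorem incl_mem_grading {n : ℕ} (y : σ.pow n) : σ.incl n y ∈ σ.grading (n : ℤ) := ⟨y, rfl⟩

theorem mul_mem_grading {m n : ℤ} {s t : σ.TensorAlg} (hs : s ∈ σ.grading m)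
    (ht : t ∈ σ.grading n) : s * t ∈ σ.grading (m + n) := by
  rcases lt_or_ge m 0 with hm | hm
  · rw [grading_of_neg hm, AddSubgroup.mem_bot] at hs
    rw [hs, zero_mul]
    exact zero_mem _
  rcases lt_or_ge n 0 with hn | hn
  · rw [grading_of_neg hn, AddSubgroup.mem_bot] at ht
    rw [ht, mul_zero]
    exact zero_mem _
  lift m to ℕ using hm
  lift n to ℕ using hn
  obtain ⟨x, rfl⟩ := hs
  obtain ⟨y, rfl⟩ := ht
  exact ⟨σ.leftMul x n y, (incl_mul_incl x y).symm⟩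

variable (σ)

/-- The component of degree `n` of the tensor algebra, as a right `A`-submodule. -/
def gradedComponent (n : ℤ) : Submodule Aᵐᵒᵖ σ.TensorAlg where
  __ := σ.grading n
  smul_mem' a t ht := by
    have h := mul_mem_grading (σ := σ) ht (incl_mem_grading (σ.ofBase (unop a)))
    rw [← scalar, ← op_smul_eq_mul, op_unop, Nat.cast_zero, add_zero] at h
    exact h

variable {σ}

theorem mem_gradedComponent {n : ℤ} {t : σ.TensorAlg} :
    t ∈ σ.gradedComponent n ↔ t ∈ σ.grading n := Iff.rfl

theorem incl_injective (n : ℕ) : Function.Injective (σ.incl n) := DirectSum.of_injective n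

variable (σ)

/-- `σ^n` is the component of degree `n` of the tensor algebra. -/
noncomputable def powEquiv (n : ℕ) : (σ.pow n : Type u) ≃ₗ[Aᵐᵒᵖ] σ.gradedComponent (n : ℤ) :=
  LinearEquiv.ofBijective ((σ.incl n).codRestrict _ fun y => incl_mem_grading y)
    ⟨fun _ _ h => incl_injective n (congrArg Subtype.val h), fun ⟨_, y, hy⟩ => ⟨y, Subtype.ext hy⟩⟩

/-- The projection of the tensor algebra onto its component of degree `n`. -/
def gradedProj : ℤ → σ.TensorAlg →ₗ[Aᵐᵒᵖ] σ.TensorAlg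
  | Int.ofNat n => σ.incl n ∘ₗ DirectSum.component Aᵐᵒᵖ ℕ (fun n => (σ.pow n).carrier) n
  | Int.negSucc _ => 0

variable {σ}

theorem gradedProj_mem (n : ℤ) (t : σ.TensorAlg) : σ.gradedProj n t ∈ σ.grading n := by
  cases n with
  | ofNat n => exact incl_mem_grading _
  | negSucc n => exact zero_mem _

theorem gradedProj_of_mem {m : ℤ} {t : σ.TensorAlg} (ht : t ∈ σ.grading m) (n : ℤ) :
    σ.gradedProj n t = if m = n then t else 0 := by
  cases m with
  | ofNat m =>
    obtain ⟨y, rfl⟩ := ht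
    cases n with
    | ofNat n =>
      by_cases h : m = n
      · subst h
        rw [if_pos rfl]
        exact congrArg (σ.incl m) (DirectSum.of_eq_same (β := fun n => (σ.pow n).carrier) m y)
      · rw [if_neg (by simpa using h)]
        exact (congrArg (σ.incl n) (DirectSum.of_eq_of_ne (β := fun n => (σ.pow n).carrier) m n y
          (Ne.symm h))).trans (map_zero _)
    | negSucc n => simp [gradedProj]
  | negSucc m =>
    have ht : t = 0 := ht
    simp [ht]

theorem finitePresentation_gradedComponent (hσ : Module.FinitePresentation Aᵐᵒᵖ σ) (n : ℤ) :
    Module.FinitePresentation Aᵐᵒᵖ (σ.gradedComponent n) := by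
  cases n with
  | ofNat n =>
    have := finitePresentation_pow σ hσ n
    exact Module.FinitePresentation.of_equiv (σ.powEquiv n)
  | negSucc n =>
    have : Subsingleton (σ.gradedComponent (Int.negSucc n)) :=
      ⟨fun x y => Subtype.ext ((show x.1 = 0 from x.2).trans (show y.1 = 0 from y.2).symm)⟩
    infer_instance

/-- Splitting off the last tensor factor, `x s ↦ x ⊗ s`. -/
def unmul (σ : Bimodule A) : σ.TensorAlg →ₗ[Aᵐᵒᵖ] Tensor A σ.TensorAlg σ :=
  DirectSum.toModule Aᵐᵒᵖ ℕ _ fun n => match n with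
    | 0 => 0
    | n + 1 => Tensor.rTensor σ (σ.incl n)

/-- So `unmul` is a left inverse of multiplication T ⊗ σ → T, which is therefore injective. -/
theorem unmul_mul (t : σ.TensorAlg) (s : σ) : σ.unmul (t * σ.inclOne s) = Tensor.tmul A t s := by
  refine DFunLike.congr_fun (f := σ.unmul.toAddMonoidHom.comp (AddMonoidHom.mulRight (σ.inclOne s)))
    (g := (Tensor.tmulHom A σ.TensorAlg σ).flip s) (DirectSum.addHom_ext fun n y => ?_) t
  change σ.unmul (σ.incl n y * σ.inclOne s) = Tensor.tmul A (σ.incl n y) s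
  rw [← incl_snoc]
  exact DirectSum.toModule_lof _ _ _

end Bimodule

end TensorAlgebra

end GrCoh

namespace GrCoh

/-! ## Graded free modules over the tensor algebra -/

section GradedFree

variable {A : Type u} [Ring A]

namespace Bimodule

variable {σ : Bimodule A}

/-- The free right module `T^k` over the tensor algebra. -/
abbrev Free (σ : Bimodule A) (k : ℕ) : Type u := Fin k → σ.TensorAlg

variable {k r : ℕ}

theorem op_smul_free (a : A) (x : σ.Free k) : op a • x = op (σ.scalar a) • x :=
  funext fun j => op_smul_eq_mul a (x j)

/-- A `T`-linear map of free modules, regarded as an `A`-linear map. -/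
def overBase (f : σ.Free k →ₗ[σ.TensorAlgᵐᵒᵖ] σ.Free r) : σ.Free k →ₗ[Aᵐᵒᵖ] σ.Free r where
  toFun := f
  map_add' := map_add f
  map_smul' a x := by
    rw [← op_unop a, op_smul_free, map_smul, RingHom.id_apply, op_smul_free]

@[simp]
theorem overBase_apply (f : σ.Free k →ₗ[σ.TensorAlgᵐᵒᵖ] σ.Free r) (x : σ.Free k) :
    overBase f x = f x := rfl

/-- The multiplication `T^k ⊗ σ^n → T^k`. -/
def mulHom (σ : Bimodule A) (k n : ℕ) : Tensor A (σ.Free k) (σ.pow n) →ₗ[Aᵐᵒᵖ] σ.Free k :=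
  Tensor.liftLinear
    ((smulAddHom σ.TensorAlgᵐᵒᵖ (σ.Free k)).comp
      ((opAddEquiv : σ.TensorAlg ≃+ _).toAddMonoidHom.comp (σ.incl n).toAddMonoidHom)).flip
    (fun x a y => by
      change op (σ.incl n y) • op a • x = op (σ.incl n (a • y)) • x
      rw [op_smul_free, ← mul_smul, ← op_mul, scalar_mul_incl])
    (fun x b y => by
      change op (σ.incl n (b • y)) • x = b • op (σ.incl n y) • x
      rw [← op_unop b, op_smul_free, ← mul_smul, ← op_mul, incl_op_smul])

theorem exists_unmul_free (σ : Bimodule A) (k : ℕ) :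
    ∃ ν : σ.Free k →ₗ[Aᵐᵒᵖ] Tensor A (σ.Free k) σ, ∀ (x : σ.Free k) (s : σ),
      ν (op (σ.inclOne s) • x) = Tensor.tmul A x s := by
  refine ⟨(Tensor.piEquiv k σ.TensorAlg σ).symm.toLinearMap ∘ₗ
    LinearMap.pi fun j => σ.unmul ∘ₗ LinearMap.proj j, fun x s => ?_⟩
  refine (LinearEquiv.symm_apply_eq _).2 ?_
  ext j
  exact unmul_mul (x j) s

/-- The associativity isomorphism `(M ⊗ σ^n) ⊗ σ ≃ M ⊗ σ^(n+1)`. -/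
def assocPow (σ : Bimodule A) (M : Type u) [AddCommGroup M] [Module Aᵐᵒᵖ M] (n : ℕ) :
    Tensor A (Tensor A M (σ.pow n)) σ ≃ₗ[Aᵐᵒᵖ] Tensor A M (σ.pow (n + 1)) :=
  Tensor.assoc A M (σ.pow n) σ

theorem assocPow_tmul {M : Type u} [AddCommGroup M] [Module Aᵐᵒᵖ M] {n : ℕ} (x : M)
    (y : σ.pow n) (s : σ) :
    σ.assocPow M n (Tensor.tmul A (Tensor.tmul A x y) s) = Tensor.tmul A x (snoc y s) := rfl

/-- The n factors from σ are stripped from the right one at a time. -/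
theorem exists_mulHom_leftInverse (σ : Bimodule A) (k n : ℕ) :
    ∃ ν : σ.Free k →ₗ[Aᵐᵒᵖ] Tensor A (σ.Free k) (σ.pow n), ∀ (x : σ.Free k) (y : σ.pow n),
      ν (op (σ.incl n y) • x) = Tensor.tmul A x y := by
  induction n with
  | zero =>
    refine ⟨(Tensor.rid A (σ.Free k)).symm.toLinearMap, fun x (a : A) => ?_⟩
    refine (LinearEquiv.symm_apply_eq _).2 ?_
    exact (op_smul_free a x).symm
  | succ n ih =>
    obtain ⟨ν, hν⟩ := ih
    obtain ⟨ν₁, hν₁⟩ := exists_unmul_free σ k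
    refine ⟨(σ.assocPow (σ.Free k) n).toLinearMap ∘ₗ Tensor.rTensor σ ν ∘ₗ ν₁,
      fun x y => ?_⟩
    induction y using pow_succ_induction with
    | h0 => simp [Tensor.tmul_zero]
    | ht y s =>
      rw [incl_snoc, op_mul, mul_smul, LinearMap.comp_apply, LinearMap.comp_apply, hν₁,
        Tensor.rTensor_tmul, hν]
      exact assocPow_tmul x y s
    | ha s t hs ht => rw [map_add, MulOpposite.op_add, add_smul, map_add, hs, ht, Tensor.tmul_add]

theorem mulHom_injective (σ : Bimodule A) (k n : ℕ) : Function.Injective (σ.mulHom k n) := by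
  obtain ⟨ν, hν⟩ := exists_mulHom_leftInverse σ k n
  refine Function.LeftInverse.injective (g := ν) ?_
  exact DFunLike.congr_fun (f := ν.toAddMonoidHom.comp (σ.mulHom k n).toAddMonoidHom)
    (g := AddMonoidHom.id _) (Tensor.hom_ext hν)

/-- The component of degree `n` of `⨁ⱼ T(-dⱼ)`, as a right `A`-module. -/
def gradedPart (σ : Bimodule A) (d : Fin k → ℤ) (n : ℤ) : Submodule Aᵐᵒᵖ (σ.Free k) :=
  Submodule.pi Set.univ fun j => σ.gradedComponent (n - d j)

variable {d : Fin k → ℤ} {e : Fin r → ℤ}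

theorem mem_gradedPart {n : ℤ} {x : σ.Free k} :
    x ∈ σ.gradedPart d n ↔ ∀ j, x j ∈ σ.grading (n - d j) := by
  simp [gradedPart, Submodule.mem_pi, mem_gradedComponent]

theorem mem_freeGrading {n : ℤ} {x : σ.Free k} :
    x ∈ freeGrading σ.grading d n ↔ x ∈ σ.gradedPart d n := by
  rw [mem_gradedPart]
  simp [freeGrading, AddSubgroup.mem_pi]

/-- The graded component of a graded free module is a product of components of the ring. -/
def gradedPartEquiv (σ : Bimodule A) (d : Fin k → ℤ) (n : ℤ) :
    σ.gradedPart d n ≃ₗ[Aᵐᵒᵖ] ((j : Fin k) → σ.gradedComponent (n - d j)) where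
  toFun x j := ⟨x.1 j, mem_gradedPart.1 x.2 j⟩
  map_add' _ _ := rfl
  map_smul' _ _ := rfl
  invFun y := ⟨fun j => y j, mem_gradedPart.2 fun j => (y j).2⟩
  left_inv _ := rfl
  right_inv _ := rfl

theorem finitePresentation_gradedPart (hσ : Module.FinitePresentation Aᵐᵒᵖ σ) (d : Fin k → ℤ)
    (n : ℤ) : Module.FinitePresentation Aᵐᵒᵖ (σ.gradedPart d n) := by
  have := finitePresentation_gradedComponent hσ
  exact Module.FinitePresentation.of_equiv (σ.gradedPartEquiv d n).symm

/-- The projection of `⨁ⱼ T(-dⱼ)` onto its component of degree `n`. -/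
def freeProj (σ : Bimodule A) (d : Fin k → ℤ) (n : ℤ) : σ.Free k →ₗ[Aᵐᵒᵖ] σ.Free k :=
  LinearMap.pi fun j => σ.gradedProj (n - d j) ∘ₗ LinearMap.proj j

theorem freeProj_apply (n : ℤ) (x : σ.Free k) (j : Fin k) :
    σ.freeProj d n x j = σ.gradedProj (n - d j) (x j) := rfl

theorem freeProj_mem (n : ℤ) (x : σ.Free k) : σ.freeProj d n x ∈ σ.gradedPart d n :=
  mem_gradedPart.2 fun _ => gradedProj_mem _ _

theorem freeProj_of_mem {m : ℤ} {x : σ.Free k} (hx : x ∈ σ.gradedPart d m) (n : ℤ) :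
    σ.freeProj d n x = if m = n then x else 0 := by
  ext1 j
  rw [freeProj_apply, gradedProj_of_mem (mem_gradedPart.1 hx j)]
  by_cases h : m = n <;> simp [h]

theorem homogeneous_induction (d : Fin k → ℤ) {p : σ.Free k → Prop} (h0 : p 0)
    (ha : ∀ x y, p x → p y → p (x + y)) (hp : ∀ n, ∀ x ∈ σ.gradedPart d n, p x)
    (x : σ.Free k) : p x := by
  rw [← Finset.univ_sum_single x]
  refine Finset.sum_induction _ p ha h0 fun j _ => ?_
  generalize x j = t
  induction t using DirectSum.induction_on with
  | zero => rwa [Pi.single_zero]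
  | of n y =>
    -- The shift T(-d j) places σ^n in degree n + d j.
    refine hp (n + d j) _ (mem_gradedPart.2 fun i => ?_)
    by_cases h : i = j
    · subst h
      rw [Pi.single_eq_same, add_sub_cancel_right]
      exact incl_mem_grading y
    · rw [Pi.single_eq_of_ne h]
      exact zero_mem _
  | add s t hs ht =>
    rw [Pi.single_add]
    exact ha _ _ hs ht

/-- Each element is the sum of its homogeneous components. -/
theorem exists_sum_freeProj (d : Fin k → ℤ) (x : σ.Free k) :
    ∃ Z : Finset ℤ, ∀ Z' : Finset ℤ, Z ⊆ Z' → ∑ n ∈ Z', σ.freeProj d n x = x := by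
  induction x using homogeneous_induction d with
  | h0 => exact ⟨∅, fun Z' _ => by simp⟩
  | ha x y hx hy =>
    obtain ⟨Z₁, h₁⟩ := hx
    obtain ⟨Z₂, h₂⟩ := hy
    refine ⟨Z₁ ∪ Z₂, fun Z' hZ => ?_⟩
    simp only [map_add, Finset.sum_add_distrib]
    rw [h₁ Z' (Finset.union_subset_left hZ), h₂ Z' (Finset.union_subset_right hZ)]
  | hp m x hx =>
    refine ⟨{m}, fun Z' hZ => ?_⟩
    simp only [freeProj_of_mem hx]
    rw [Finset.sum_ite_eq, if_pos (hZ (Finset.mem_singleton_self m))]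

/-- A map `⨁ⱼ T(-dⱼ) → ⨁ᵢ T(-eᵢ)` is graded if it preserves degrees. -/
def IsGraded (d : Fin k → ℤ) (e : Fin r → ℤ) (f : σ.Free k →ₗ[σ.TensorAlgᵐᵒᵖ] σ.Free r) : Prop :=
  ∀ n, ∀ x ∈ σ.gradedPart d n, f x ∈ σ.gradedPart e n

variable {f : σ.Free k →ₗ[σ.TensorAlgᵐᵒᵖ] σ.Free r}

theorem IsGraded.freeProj (hf : IsGraded d e f) (n : ℤ) (x : σ.Free k) :
    σ.freeProj e n (f x) = f (σ.freeProj d n x) := by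
  induction x using homogeneous_induction d with
  | h0 => simp
  | ha x y hx hy => rw [map_add, map_add, map_add, map_add, hx, hy]
  | hp m x hx =>
    rw [freeProj_of_mem hx, freeProj_of_mem (hf m x hx)]
    split_ifs <;> simp

theorem op_smul_mem_gradedPart {m n : ℤ} {x : σ.Free k} (hx : x ∈ σ.gradedPart d m)
    {t : σ.TensorAlg} (ht : t ∈ σ.grading n) : op t • x ∈ σ.gradedPart d (m + n) := by
  rw [mem_gradedPart] at hx ⊢
  intro j
  rw [add_sub_right_comm]
  exact mul_mem_grading (hx j) ht

/-- The multiplication `G ⊗ σ^n → T^k` for a right `A`-submodule `G` of `T^k`. -/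
def mulSub (G : Submodule Aᵐᵒᵖ (σ.Free k)) (n : ℕ) : Tensor A G (σ.pow n) →ₗ[Aᵐᵒᵖ] σ.Free k :=
  σ.mulHom k n ∘ₗ Tensor.rTensor (σ.pow n) G.subtype

@[simp]
theorem mulSub_tmul (G : Submodule Aᵐᵒᵖ (σ.Free k)) {n : ℕ} (x : G) (y : σ.pow n) :
    mulSub G n (Tensor.tmul A x y) = op (σ.incl n y) • x.1 := rfl

theorem mulSub_mem {G : Submodule Aᵐᵒᵖ (σ.Free k)} {n : ℕ} {H : Submodule Aᵐᵒᵖ (σ.Free k)}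
    (h : ∀ x ∈ G, ∀ y : σ.pow n, op (σ.incl n y) • x ∈ H) (t : Tensor A G (σ.pow n)) :
    mulSub G n t ∈ H := by
  induction t using Tensor.induction with
  | h0 => rw [map_zero]; exact zero_mem _
  | ht x y => exact h x x.2 y
  | ha s t hs ht => rw [map_add]; exact add_mem hs ht

theorem mulSub_gradedPart_mem (d : Fin k → ℤ) (m : ℤ) {n : ℕ}
    (t : Tensor A (σ.gradedPart d m) (σ.pow n)) :
    mulSub (σ.gradedPart d m) n t ∈ σ.gradedPart d (m + n) :=
  mulSub_mem (fun _ hx y => op_smul_mem_gradedPart hx (incl_mem_grading y)) t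

/-- A graded component is a direct summand of T^k over A, so its inclusion stays injective after
tensoring, with no flatness of σ^n. -/
theorem mulSub_gradedPart_injective (d : Fin k → ℤ) (m : ℤ) (n : ℕ) :
    Function.Injective (mulSub (σ.gradedPart d m) n) := by
  refine (mulHom_injective σ k n).comp ?_
  let ρ : σ.Free k →ₗ[Aᵐᵒᵖ] σ.gradedPart d m := (σ.freeProj d m).codRestrict _ (freeProj_mem m)
  have h : ρ ∘ₗ (σ.gradedPart d m).subtype = LinearMap.id :=
    LinearMap.ext fun x => Subtype.ext ((freeProj_of_mem x.2 m).trans (if_pos rfl))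
  refine Function.LeftInverse.injective (g := Tensor.rTensor (σ.pow n) ρ) fun t => ?_
  rw [← LinearMap.comp_apply, ← Tensor.rTensor_comp, h, Tensor.rTensor_id, LinearMap.id_apply]

/-- Coordinate j of `x` lies in σ^(c+n) with c = m - d j ≥ 0, and splits into products from σ^c and
σ^n. With injectivity of multiplication this gives F_(m+n) = F_m ⊗ σ^n. -/
theorem exists_mulSub_eq {m : ℤ} (hm : ∀ j, d j ≤ m) {n : ℕ} {x : σ.Free k}
    (hx : x ∈ σ.gradedPart d (m + n)) : ∃ t, mulSub (σ.gradedPart d m) n t = x := by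
  change x ∈ LinearMap.range (mulSub (σ.gradedPart d m) n)
  rw [← Finset.univ_sum_single x]
  refine sum_mem fun j _ => ?_
  have hj := mem_gradedPart.1 hx j
  obtain ⟨c, hc⟩ := Int.eq_ofNat_of_zero_le (sub_nonneg.2 (hm j))
  rw [add_sub_right_comm, hc, ← Nat.cast_add] at hj
  obtain ⟨z, hz⟩ := hj
  rw [← hz]
  refine mul_induction (p := fun t => (Pi.single j t : σ.Free k) ∈ LinearMap.range _) ?_ ?_ ?_ z
  · rw [Pi.single_zero]
    exact zero_mem _
  · intro s t hs ht
    rw [Pi.single_add]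
    exact add_mem hs ht
  · intro u v
    have hu : (Pi.single j (σ.incl c u) : σ.Free k) ∈ σ.gradedPart d m := by
      refine mem_gradedPart.2 fun i => ?_
      by_cases h : i = j
      · subst h
        rw [Pi.single_eq_same, hc]
        exact incl_mem_grading u
      · rw [Pi.single_eq_of_ne h]
        exact zero_mem _
    refine ⟨Tensor.tmul A (⟨_, hu⟩ : σ.gradedPart d m) v, ?_⟩
    rw [mulSub_tmul]
    ext1 i
    by_cases h : i = j
    · subst h
      simp
    · simp [h]

end Bimodule

end GradedFree

end GrCoh

namespace GrCoh

/-! ## Images, kernels and cokernels of graded maps in a single degree -/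

theorem nonempty_equiv_of_ker_eq {R : Type u} [Ring R] {L M M' : Type u} [AddCommGroup L]
    [Module R L] [AddCommGroup M] [Module R M] [AddCommGroup M'] [Module R M'] {f : L →ₗ[R] M}
    {g : L →ₗ[R] M'} (hf : Function.Surjective f) (hg : Function.Surjective g)
    (h : LinearMap.ker f = LinearMap.ker g) : Nonempty (M ≃ₗ[R] M') :=
  ⟨(f.quotKerEquivOfSurjective hf).symm ≪≫ₗ Submodule.quotEquivOfEq _ _ h ≪≫ₗ
    g.quotKerEquivOfSurjective hg⟩

section GradedMaps

variable {A : Type u} [Ring A]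

namespace Bimodule

variable {σ : Bimodule A} {k r : ℕ}

/-- The image of the component of degree `n`. -/
def imPart (f : σ.Free k →ₗ[σ.TensorAlgᵐᵒᵖ] σ.Free r) (d : Fin k → ℤ) (n : ℤ) :
    Submodule Aᵐᵒᵖ (σ.Free r) :=
  (σ.gradedPart d n).map (overBase f)

/-- The component of degree `n` of the kernel. -/
def kerPart (f : σ.Free k →ₗ[σ.TensorAlgᵐᵒᵖ] σ.Free r) (d : Fin k → ℤ) (n : ℤ) :
    Submodule Aᵐᵒᵖ (σ.Free k) :=
  σ.gradedPart d n ⊓ LinearMap.ker (overBase f)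

/-- The component of degree `n` of the cokernel. -/
abbrev CokPart (f : σ.Free k →ₗ[σ.TensorAlgᵐᵒᵖ] σ.Free r) (d : Fin k → ℤ) (e : Fin r → ℤ)
    (n : ℤ) : Type u :=
  σ.gradedPart e n ⧸ (imPart f d n).submoduleOf (σ.gradedPart e n)

variable {f : σ.Free k →ₗ[σ.TensorAlgᵐᵒᵖ] σ.Free r} {d : Fin k → ℤ} {e : Fin r → ℤ}

theorem mem_kerPart {n : ℤ} {x : σ.Free k} :
    x ∈ kerPart f d n ↔ x ∈ σ.gradedPart d n ∧ f x = 0 := Iff.rfl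

theorem imPart_le (hf : IsGraded d e f) (n : ℤ) : imPart f d n ≤ σ.gradedPart e n := by
  rintro _ ⟨x, hx, rfl⟩
  exact hf n x hx

theorem kerPart_le (f : σ.Free k →ₗ[σ.TensorAlgᵐᵒᵖ] σ.Free r) (d : Fin k → ℤ) (n : ℤ) :
    kerPart f d n ≤ σ.gradedPart d n := inf_le_left

theorem mulSub_inclusion {G H : Submodule Aᵐᵒᵖ (σ.Free k)} (h : G ≤ H) {n : ℕ}
    (t : Tensor A G (σ.pow n)) :
    mulSub H n (Tensor.rTensor (σ.pow n) (Submodule.inclusion h) t) = mulSub G n t :=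
  DFunLike.congr_fun
    (f := (mulSub H n ∘ₗ Tensor.rTensor (σ.pow n) (Submodule.inclusion h)).toAddMonoidHom)
    (g := (mulSub G n).toAddMonoidHom) (Tensor.hom_ext fun _ _ => rfl) t

/-- The map from the component of degree `n` onto its image. -/
def toImPart (f : σ.Free k →ₗ[σ.TensorAlgᵐᵒᵖ] σ.Free r) (d : Fin k → ℤ) (n : ℤ) :
    σ.gradedPart d n →ₗ[Aᵐᵒᵖ] imPart f d n :=
  (overBase f).submoduleMap (σ.gradedPart d n)

theorem toImPart_surjective (f : σ.Free k →ₗ[σ.TensorAlgᵐᵒᵖ] σ.Free r) (d : Fin k → ℤ) (n : ℤ) :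
    Function.Surjective (toImPart f d n) :=
  LinearMap.submoduleMap_surjective _ _

theorem exact_toImPart (f : σ.Free k →ₗ[σ.TensorAlgᵐᵒᵖ] σ.Free r) (d : Fin k → ℤ) (n : ℤ) :
    Function.Exact (Submodule.inclusion (kerPart_le f d n)) (toImPart f d n) := by
  intro x
  constructor
  · intro hx
    exact ⟨⟨x.1, x.2, congrArg Subtype.val hx⟩, rfl⟩
  · rintro ⟨y, rfl⟩
    exact Subtype.ext y.2.2

theorem mulSub_toImPart {m : ℤ} {n : ℕ} (t : Tensor A (σ.gradedPart d m) (σ.pow n)) :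
    mulSub (imPart f d m) n (Tensor.rTensor (σ.pow n) (toImPart f d m) t) =
      f (mulSub (σ.gradedPart d m) n t) :=
  DFunLike.congr_fun
    (f := (mulSub (imPart f d m) n ∘ₗ
      Tensor.rTensor (σ.pow n) (toImPart f d m)).toAddMonoidHom)
    (g := (overBase f ∘ₗ mulSub (σ.gradedPart d m) n).toAddMonoidHom)
    (Tensor.hom_ext fun x y => (map_smul f (op (σ.incl n y)) x.1).symm) t

/-- The source is generated in degrees at most m and f is T-linear. -/
theorem range_mulSub_imPart {m : ℤ} (hm : ∀ j, d j ≤ m) (n : ℕ) :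
    LinearMap.range (mulSub (imPart f d m) n) = imPart f d (m + n) := by
  ext x
  constructor
  · rintro ⟨t, rfl⟩
    obtain ⟨t, rfl⟩ := Tensor.rTensor_surjective (N := σ.pow n) (toImPart_surjective f d m) t
    rw [mulSub_toImPart]
    exact ⟨_, mulSub_gradedPart_mem d m t, rfl⟩
  · rintro ⟨y, hy, rfl⟩
    obtain ⟨t, rfl⟩ := exists_mulSub_eq hm hy
    exact ⟨_, mulSub_toImPart t⟩

/-- If the kernel is generated in degree `m` in degree `m + n`, then the product with `σ^n` is
injective on the image in degree `m`. -/
theorem mulSub_imPart_injective {m : ℤ} {n : ℕ}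
    (h : kerPart f d (m + n) ≤ LinearMap.range (mulSub (kerPart f d m) n)) :
    Function.Injective (mulSub (imPart f d m) n) := by
  rw [injective_iff_map_eq_zero]
  intro t ht
  obtain ⟨s, rfl⟩ := Tensor.rTensor_surjective (N := σ.pow n) (toImPart_surjective f d m) t
  rw [mulSub_toImPart] at ht
  -- The product of the lift `s` lies in the kernel, hence comes from Z_m ⊗ σ^n. Injectivity of
  -- multiplication on F_m ⊗ σ^n puts `s` itself in the image of Z_m ⊗ σ^n, so it dies in I_m ⊗ σ^n.
  obtain ⟨u, hu⟩ := h (mem_kerPart.2 ⟨mulSub_gradedPart_mem d m s, ht⟩)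
  rw [← mulSub_inclusion (kerPart_le f d m)] at hu
  rw [← mulSub_gradedPart_injective d m n hu]
  exact (Tensor.exact_rTensor (N := σ.pow n) (exact_toImPart f d m)
    (toImPart_surjective f d m)).apply_apply_eq_zero u

/-- Converse of `mulSub_imPart_injective`. The degree bound is what writes a kernel element as a
product from F_m ⊗ σ^n, and right exactness then moves it into Z_m ⊗ σ^n. -/
theorem kerPart_le_range {m : ℤ} (hm : ∀ j, d j ≤ m) {n : ℕ}
    (h : Function.Injective (mulSub (imPart f d m) n)) :
    kerPart f d (m + n) ≤ LinearMap.range (mulSub (kerPart f d m) n) := by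
  intro x hx
  obtain ⟨hx, hfx⟩ := mem_kerPart.1 hx
  obtain ⟨s, rfl⟩ := exists_mulSub_eq hm hx
  rw [← mulSub_toImPart, map_eq_zero_iff _ h] at hfx
  obtain ⟨u, rfl⟩ := (Tensor.exact_rTensor (N := σ.pow n) (exact_toImPart f d m)
    (toImPart_surjective f d m) s).1 hfx
  exact ⟨u, (mulSub_inclusion _ u).symm⟩

theorem exact_cokPart (hf : IsGraded d e f) (n : ℤ) :
    Function.Exact (Submodule.inclusion (imPart_le hf n))
      ((imPart f d n).submoduleOf (σ.gradedPart e n)).mkQ := by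
  intro x
  rw [← LinearMap.mem_ker, Submodule.ker_mkQ]
  exact ⟨fun hx => ⟨⟨x.1, hx⟩, rfl⟩, by rintro ⟨y, rfl⟩; exact y.2⟩

/-- Multiplication on I_m ⊗ σ^n is the map to G_m ⊗ σ^n followed by an injection. As Tor_1(G_m, σ^n)
= 0, the kernel of the first map measures Tor_1(C_m, σ^n). This is the bridge between Tor and
generation of kernels. -/
theorem extZero_cokPart_iff (hf : IsGraded d e f) {m : ℤ} {n : ℕ}
    (h : ExtZero (dualModule (σ.pow n)) 1 (σ.gradedPart e m)) :
    ExtZero (dualModule (σ.pow n)) 1 (CokPart f d e m) ↔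
      Function.Injective (mulSub (imPart f d m) n) := by
  have hi := Submodule.inclusion_injective (imPart_le hf m)
  have hs := Submodule.mkQ_surjective ((imPart f d m).submoduleOf (σ.gradedPart e m))
  have h1 : ExtZero (dualModule (σ.pow n)) 1 (CokPart f d e m) ↔
      Function.Injective (Tensor.rTensor (σ.pow n) (Submodule.inclusion (imPart_le hf m))) := by
    rw [Tensor.rTensor_injective_iff]
    exact ⟨ExtZero.extends hi (exact_cokPart hf m) hs,
      ExtZero.of_extends hi (exact_cokPart hf m) hs h⟩
  rw [h1, ← (mulSub_gradedPart_injective e m n).of_comp_iff]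
  have h2 : (mulSub (σ.gradedPart e m) n) ∘
      (Tensor.rTensor (σ.pow n) (Submodule.inclusion (imPart_le hf m))) =
        mulSub (imPart f d m) n := funext fun t => mulSub_inclusion _ t
  rw [h2]

/-- Both sides are quotients of G_m ⊗ σ^n with the same kernel. The bound on `e` makes
multiplication onto G_(m+n), and the bound on `d` gives I_m σ^n = I_(m+n). -/
theorem nonempty_cokPart_tensor_equiv (hf : IsGraded d e f) {m : ℤ} (hd : ∀ j, d j ≤ m)
    (he : ∀ j, e j ≤ m) (n : ℕ) :
    Nonempty (Tensor A (CokPart f d e m) (σ.pow n) ≃ₗ[Aᵐᵒᵖ] CokPart f d e (m + n)) := by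
  let θ : Tensor A (σ.gradedPart e m) (σ.pow n) →ₗ[Aᵐᵒᵖ] σ.gradedPart e (m + n) :=
    (mulSub (σ.gradedPart e m) n).codRestrict _ (mulSub_gradedPart_mem e m)
  have hθ : Function.Surjective θ := fun x => by
    obtain ⟨t, ht⟩ := exists_mulSub_eq he x.2
    exact ⟨t, Subtype.ext ht⟩
  refine nonempty_equiv_of_ker_eq (L := Tensor A (σ.gradedPart e m) (σ.pow n))
    (f := Tensor.rTensor (σ.pow n) ((imPart f d m).submoduleOf (σ.gradedPart e m)).mkQ)
    (g := ((imPart f d (m + n)).submoduleOf (σ.gradedPart e (m + n))).mkQ ∘ₗ θ)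
    (Tensor.rTensor_surjective (Submodule.mkQ_surjective _))
    ((Submodule.mkQ_surjective _).comp hθ) ?_
  have he := Tensor.exact_rTensor (N := σ.pow n) (exact_cokPart hf m) (Submodule.mkQ_surjective _)
  ext t
  rw [LinearMap.mem_ker, he t, LinearMap.ker_comp, Submodule.ker_mkQ, Submodule.mem_comap]
  change _ ↔ mulSub (σ.gradedPart e m) n t ∈ imPart f d (m + n)
  rw [← range_mulSub_imPart hd]
  constructor
  · rintro ⟨u, rfl⟩
    exact ⟨u, (mulSub_inclusion _ u).symm⟩
  · rintro ⟨u, hu⟩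
    refine ⟨u, mulSub_gradedPart_injective e m n ?_⟩
    rw [mulSub_inclusion, hu]

theorem imPart_fg (hσ : Module.FinitePresentation Aᵐᵒᵖ σ) (n : ℤ) : (imPart f d n).FG := by
  have := finitePresentation_gradedPart hσ d n
  exact (Module.Finite.iff_fg.1 inferInstance : (σ.gradedPart d n).FG).map _

theorem submoduleOf_imPart_fg (hσ : Module.FinitePresentation Aᵐᵒᵖ σ)
    (hf : IsGraded d e f) (n : ℤ) :
    ((imPart f d n).submoduleOf (σ.gradedPart e n)).FG := by
  have h := imPart_fg (f := f) (d := d) hσ n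
  have : Module.Finite Aᵐᵒᵖ (imPart f d n) := Module.Finite.iff_fg.2 h
  exact Module.Finite.iff_fg.1
    (Module.Finite.equiv (Submodule.submoduleOfEquivOfLe (imPart_le hf n)).symm)

theorem finitePresentation_imPart (hσ : Module.FinitePresentation Aᵐᵒᵖ σ) (hA : IsRightCoherent A)
    (hf : IsGraded d e f) (n : ℤ) :
    Module.FinitePresentation Aᵐᵒᵖ (imPart f d n) := by
  have := finitePresentation_gradedPart hσ e n
  have := hA.finitePresentation (submoduleOf_imPart_fg hσ hf n)
  exact Module.FinitePresentation.of_equiv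
    (M := (imPart f d n).submoduleOf (σ.gradedPart e n))
    (Submodule.submoduleOfEquivOfLe (imPart_le hf n))

theorem finitePresentation_cokPart (hσ : Module.FinitePresentation Aᵐᵒᵖ σ)
    (hf : IsGraded d e f) (n : ℤ) :
    Module.FinitePresentation Aᵐᵒᵖ (CokPart f d e n) := by
  have := finitePresentation_gradedPart hσ e n
  exact finitePresentation_quotient (submoduleOf_imPart_fg hσ hf n)

/-- The image in degree n is finitely presented over the coherent ring A, so the kernel of the map
onto it is finitely generated. -/
theorem kerPart_fg (hσ : Module.FinitePresentation Aᵐᵒᵖ σ) (hA : IsRightCoherent A)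
    (hf : IsGraded d e f) (n : ℤ) :
    (kerPart f d n).FG := by
  have := finitePresentation_gradedPart hσ d n
  have := finitePresentation_imPart hσ hA hf n
  have h := (hA.ker_fg (toImPart f d n)).map (σ.gradedPart d n).subtype
  rw [LinearMap.exact_iff.1 (exact_toImPart f d n), Submodule.range_inclusion,
    Submodule.map_comap_subtype, inf_eq_right.2 (kerPart_le f d n)] at h
  exact h

end Bimodule

end GradedMaps

end GrCoh

namespace GrCoh

/-! ## Graded coherence of the tensor algebra -/

section GradedCoherence

variable {A : Type u} [Ring A]

namespace Bimodule

variable {σ : Bimodule A} {k r s : ℕ}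

/-- The map `T^s → T^k` sending the standard basis to the given elements. -/
def combo (b : Fin s → σ.Free k) : σ.Free s →ₗ[σ.TensorAlgᵐᵒᵖ] σ.Free k :=
  ∑ i, LinearMap.toSpanSingleton σ.TensorAlgᵐᵒᵖ _ (b i) ∘ₗ
    (opEquiv σ.TensorAlg).toLinearMap ∘ₗ LinearMap.proj i

theorem combo_apply (b : Fin s → σ.Free k) (x : σ.Free s) :
    combo b x = ∑ i, op (x i) • b i := by
  simp only [combo, LinearMap.sum_apply]
  rfl

theorem range_combo (b : Fin s → σ.Free k) :
    LinearMap.range (combo b) = Submodule.span σ.TensorAlgᵐᵒᵖ (Set.range b) := by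
  apply le_antisymm
  · rintro _ ⟨x, rfl⟩
    rw [combo_apply]
    exact sum_mem fun i _ => Submodule.smul_mem _ _ (Submodule.subset_span ⟨i, rfl⟩)
  · rw [Submodule.span_le]
    rintro _ ⟨i, rfl⟩
    refine ⟨Pi.single i 1, ?_⟩
    rw [combo_apply, Finset.sum_eq_single i]
    · rw [Pi.single_eq_same, op_one, one_smul]
    · intro j _ hj
      rw [Pi.single_eq_of_ne hj, op_zero, zero_smul]
    · simp

theorem isGraded_combo {d : Fin k → ℤ} {c : Fin s → ℤ} {b : Fin s → σ.Free k}
    (hb : ∀ i, b i ∈ σ.gradedPart d (c i)) : IsGraded c d (combo b) := by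
  intro n x hx
  rw [combo_apply]
  refine sum_mem fun i _ => ?_
  have h := op_smul_mem_gradedPart (hb i) (mem_gradedPart.1 hx i)
  rwa [add_sub_cancel] at h

/-- A finitely generated graded submodule is generated by finitely many homogeneous elements. -/
theorem exists_graded_range_eq {d : Fin k → ℤ} {G : Submodule σ.TensorAlgᵐᵒᵖ (σ.Free k)}
    (hG : G.FG) (hproj : ∀ n, ∀ x ∈ G, σ.freeProj d n x ∈ G) :
    ∃ (s : ℕ) (c : Fin s → ℤ) (g : σ.Free s →ₗ[σ.TensorAlgᵐᵒᵖ] σ.Free k),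
      IsGraded c d g ∧ LinearMap.range g = G := by
  obtain ⟨S, hS⟩ := hG
  choose Z hZ using fun x : σ.Free k => exists_sum_freeProj (σ := σ) d x
  -- The new generators are the homogeneous components of the old ones, indexed by generator and
  -- degree.
  let P : Finset (Σ _ : σ.Free k, ℤ) := S.sigma Z
  let b : Fin P.card → σ.Free k := fun i =>
    σ.freeProj d (P.equivFin.symm i).1.2 (P.equivFin.symm i).1.1
  refine ⟨P.card, fun i => (P.equivFin.symm i).1.2, combo b,
    isGraded_combo fun i => freeProj_mem _ _, ?_⟩
  rw [range_combo]
  apply le_antisymm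
  · rw [Submodule.span_le]
    rintro _ ⟨i, rfl⟩
    refine hproj _ _ ?_
    rw [← hS]
    exact Submodule.subset_span (Finset.mem_sigma.1 (P.equivFin.symm i).2).1
  · rw [← hS, Submodule.span_le]
    intro x hx
    rw [SetLike.mem_coe, ← hZ x (Z x) subset_rfl]
    refine sum_mem fun n hn => Submodule.subset_span ?_
    refine ⟨P.equivFin ⟨⟨x, n⟩, Finset.mem_sigma.2 ⟨hx, hn⟩⟩, ?_⟩
    simp [b]

theorem IsGraded.freeProj_mem_ker {d : Fin k → ℤ} {e : Fin r → ℤ}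
    {f : σ.Free k →ₗ[σ.TensorAlgᵐᵒᵖ] σ.Free r} (hf : IsGraded d e f) (n : ℤ) {x : σ.Free k}
    (hx : x ∈ LinearMap.ker f) : σ.freeProj d n x ∈ LinearMap.ker f := by
  rw [LinearMap.mem_ker] at hx ⊢
  rw [← hf.freeProj, hx, map_zero]

/-- Over a graded coherent tensor algebra the kernel of a graded map of finitely generated graded
free modules is the image of such a map. -/
theorem exists_graded_range_eq_ker (h : IsGradedRightCoherent σ.grading) {d : Fin k → ℤ}
    {e : Fin r → ℤ} {f : σ.Free k →ₗ[σ.TensorAlgᵐᵒᵖ] σ.Free r} (hf : IsGraded d e f) :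
    ∃ (s : ℕ) (c : Fin s → ℤ) (g : σ.Free s →ₗ[σ.TensorAlgᵐᵒᵖ] σ.Free k),
      IsGraded c d g ∧ LinearMap.range g = LinearMap.ker f := by
  induction r with
  | zero =>
    refine ⟨k, d, LinearMap.id, fun n x hx => hx, ?_⟩
    rw [LinearMap.range_id, Subsingleton.elim f 0, LinearMap.ker_zero]
  | succ r ih =>
    obtain ⟨s, c, g, hg, hgf⟩ := ih (e := fun i => e i.succ)
      (f := LinearMap.funLeft σ.TensorAlgᵐᵒᵖ σ.TensorAlg Fin.succ ∘ₗ f)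
      (fun n x hx => mem_gradedPart.2 fun j => mem_gradedPart.1 (hf n x hx) j.succ)
    -- Coordinate 0 maps to T(-e 0), while graded coherence concerns maps to T. Lowering the source
    -- shifts by `e 0` compensates.
    have hfg := h.2 s (fun j => c j - e 0) (LinearMap.proj 0 ∘ₗ f ∘ₗ g) (fun n x hx => by
      have hx' : x ∈ σ.gradedPart c (n + e 0) := by
        rw [mem_freeGrading] at hx
        rw [mem_gradedPart] at hx ⊢
        intro j
        have := hx j
        rwa [show n - (c j - e 0) = n + e 0 - c j by ring] at this
      have := mem_gradedPart.1 (hf _ _ (hg _ x hx')) 0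
      rwa [add_sub_cancel_right] at this)
    obtain ⟨s', c', g', hg', hgf'⟩ := exists_graded_range_eq (d := c) hfg (fun n x hx => by
      rw [LinearMap.mem_ker] at hx ⊢
      simp only [LinearMap.comp_apply, LinearMap.proj_apply]
      rw [← hg.freeProj, ← hf.freeProj, freeProj_apply]
      have hx' : f (g x) 0 = 0 := hx
      rw [hx', map_zero])
    refine ⟨s', c', g ∘ₗ g', fun n x hx => hg _ _ (hg' n x hx), ?_⟩
    rw [LinearMap.range_comp, hgf']
    ext x
    simp only [LinearMap.mem_ker, Submodule.mem_map, LinearMap.comp_apply]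
    constructor
    · rintro ⟨y, hy, rfl⟩
      have hy' : g y ∈ LinearMap.range g := ⟨y, rfl⟩
      rw [hgf, LinearMap.mem_ker] at hy'
      exact funext fun i => Fin.cases hy (fun j => congrFun hy' j) i
    · intro hx
      have hx' : x ∈ LinearMap.range g := by
        rw [hgf, LinearMap.mem_ker, LinearMap.comp_apply, hx, map_zero]
      obtain ⟨y, rfl⟩ := hx'
      exact ⟨y, by rw [hx]; rfl, rfl⟩

theorem exists_le_natCast (d : Fin k → ℤ) : ∃ N : ℕ, ∀ j, d j ≤ N ∧ -(N : ℤ) ≤ d j := by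
  refine ⟨∑ j, (d j).natAbs, fun j => ?_⟩
  have := Finset.single_le_sum (f := fun j => (d j).natAbs) (fun _ _ => Nat.zero_le _)
    (Finset.mem_univ j)
  omega

/-- Over a graded coherent tensor algebra, kernels of graded maps are generated in low degrees. -/
theorem exists_kerPart_le (h : IsGradedRightCoherent σ.grading) {d : Fin k → ℤ} {e : Fin r → ℤ}
    {f : σ.Free k →ₗ[σ.TensorAlgᵐᵒᵖ] σ.Free r} (hf : IsGraded d e f) :
    ∃ N : ℕ, ∀ m : ℕ, N ≤ m → ∀ n : ℕ,
      kerPart f d (m + n) ≤ LinearMap.range (mulSub (kerPart f d m) n) := by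
  obtain ⟨s, c, g, hg, hgf⟩ := exists_graded_range_eq_ker h hf
  obtain ⟨N, hN⟩ := exists_le_natCast c
  refine ⟨N, fun m hm n x hx => ?_⟩
  obtain ⟨hx, hfx⟩ := mem_kerPart.1 hx
  have hle : imPart g c m ≤ kerPart f d m := by
    rintro _ ⟨y, hy, rfl⟩
    refine mem_kerPart.2 ⟨hg _ y hy, ?_⟩
    have : g y ∈ LinearMap.range g := ⟨y, rfl⟩
    rwa [hgf] at this
  have hxg : x ∈ LinearMap.range g := by rwa [hgf]
  obtain ⟨y, hy⟩ := hxg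
  -- A preimage of `x` may be inhomogeneous, but its component of degree m + n has the same image.
  have hx' : x ∈ imPart g c (m + n) := by
    refine ⟨σ.freeProj c (m + n) y, freeProj_mem _ _, ?_⟩
    rw [overBase_apply, ← hg.freeProj, hy, freeProj_of_mem hx, if_pos rfl]
  rw [← range_mulSub_imPart (fun j => (hN j).1.trans (by exact_mod_cast hm))] at hx'
  obtain ⟨t, rfl⟩ := hx'
  exact ⟨_, mulSub_inclusion hle t⟩

theorem kerPart_of_lt (f : σ.Free k →ₗ[σ.TensorAlgᵐᵒᵖ] σ.Free r) {d : Fin k → ℤ} {n : ℤ}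
    (hn : ∀ j, n < d j) : kerPart f d n = ⊥ := by
  rw [eq_bot_iff]
  intro x hx
  rw [Submodule.mem_bot]
  ext1 j
  have h := mem_gradedPart.1 (mem_kerPart.1 hx).1 j
  rwa [grading_of_neg (sub_neg.2 (hn j))] at h

/-- If the homogeneous components of the kernel are finitely generated, and the kernel is generated
in low degrees, then it is finitely generated. -/
theorem ker_fg_of_kerPart_le {d : Fin k → ℤ} {e : Fin r → ℤ}
    {f : σ.Free k →ₗ[σ.TensorAlgᵐᵒᵖ] σ.Free r} (hf : IsGraded d e f)
    (hfg : ∀ n, (kerPart f d n).FG) {m : ℕ}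
    (h : ∀ n : ℕ, kerPart f d (m + n) ≤ LinearMap.range (mulSub (kerPart f d m) n)) :
    (LinearMap.ker f).FG := by
  obtain ⟨N, hN⟩ := exists_le_natCast d
  let U : ℤ → Submodule σ.TensorAlgᵐᵒᵖ (σ.Free k) := fun n =>
    Submodule.span σ.TensorAlgᵐᵒᵖ (kerPart f d n : Set (σ.Free k))
  -- Generators of the degree n piece over A also generate its T-span.
  have hU : ∀ n, (U n).FG := by
    intro n
    obtain ⟨S, hS⟩ := hfg n
    refine ⟨S, le_antisymm (Submodule.span_mono fun x hx => ?_) (Submodule.span_le.2 ?_)⟩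
    · rw [← hS]
      exact Submodule.subset_span hx
    · intro x hx
      rw [← hS] at hx
      induction hx using Submodule.span_induction with
      | mem x hx => exact Submodule.subset_span hx
      | zero => exact zero_mem _
      | add x y _ _ hx hy => exact add_mem hx hy
      | smul a x _ hx =>
        rw [← op_unop a, op_smul_free]
        exact Submodule.smul_mem _ _ hx
  -- Below -N the source vanishes, and above m the kernel is generated from degree m, so finitely
  -- many degrees suffice.
  have key : LinearMap.ker f = ⨆ n ∈ Finset.Icc (-(N : ℤ)) m, U n := by
    apply le_antisymm
    · intro x hx
      obtain ⟨Z, hZ⟩ := exists_sum_freeProj d x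
      rw [← hZ Z subset_rfl]
      refine sum_mem fun n _ => ?_
      have hxn : σ.freeProj d n x ∈ kerPart f d n :=
        mem_kerPart.2 ⟨freeProj_mem n x, hf.freeProj_mem_ker n hx⟩
      rcases lt_or_ge n (-(N : ℤ)) with hn | hn
      · rw [kerPart_of_lt f fun j => hn.trans_le (hN j).2] at hxn
        rw [(Submodule.mem_bot _).1 hxn]
        exact zero_mem _
      rcases le_or_gt n m with hnm | hnm
      · exact (le_iSup₂_of_le (f := fun n (_ : n ∈ Finset.Icc (-(N : ℤ)) m) => U n) n
          (Finset.mem_Icc.2 ⟨hn, hnm⟩) le_rfl) (Submodule.subset_span hxn)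
      · obtain ⟨c, hc⟩ := Int.eq_ofNat_of_zero_le (sub_nonneg.2 hnm.le)
        obtain rfl : n = m + c := by omega
        obtain ⟨t, ht⟩ := h c hxn
        rw [← ht]
        clear ht
        refine (le_iSup₂_of_le (f := fun n (_ : n ∈ Finset.Icc (-(N : ℤ)) m) => U n) (m : ℤ)
          (Finset.mem_Icc.2 ⟨by omega, le_rfl⟩) le_rfl) ?_
        induction t using Tensor.induction with
        | h0 => rw [map_zero]; exact zero_mem _
        | ht x y => exact Submodule.smul_mem _ _ (Submodule.subset_span x.2)
        | ha s t hs ht => rw [map_add]; exact add_mem hs ht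
    · refine iSup₂_le fun n _ => Submodule.span_le.2 fun x hx => (mem_kerPart.1 hx).2
  rw [key]
  exact Submodule.fg_biSup _ _ fun n _ => hU n

/-- `Tor_i(T^r_m, σ^n) = 0` for `i ≥ 1`. -/
theorem extZero_gradedPart {n i : ℕ} (h : ∀ m, ExtZero (dualModule (σ.pow n)) i (σ.pow m))
    (r m : ℕ) : ExtZero (dualModule (σ.pow n)) i (σ.gradedPart (fun _ : Fin r => 0) m) := by
  refine ((h m).pi r).of_equiv (LinearEquiv.symm ?_)
  refine σ.gradedPartEquiv (fun _ : Fin r => 0) m ≪≫ₗ LinearEquiv.piCongrRight fun _ => ?_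
  exact LinearEquiv.ofEq _ _ (by rw [sub_zero]) ≪≫ₗ (σ.powEquiv m).symm

theorem scalar_injective (σ : Bimodule A) : Function.Injective σ.scalar := incl_injective 0

/-- `A^r` is the degree zero part of `T^r`. -/
def scalarMap (σ : Bimodule A) (r : ℕ) :
    (Fin r → A) →ₗ[Aᵐᵒᵖ] σ.gradedPart (fun _ : Fin r => 0) 0 where
  toFun x := ⟨fun i => σ.scalar (x i), mem_gradedPart.2 fun _ => incl_mem_grading _⟩
  map_add' x y := Subtype.ext (funext fun i => scalar_add (x i) (y i))
  map_smul' a x := Subtype.ext (funext fun i => map_smul (σ.incl 0) a (σ.ofBase (x i)))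

theorem scalarMap_surjective (σ : Bimodule A) (r : ℕ) : Function.Surjective (σ.scalarMap r) := by
  intro y
  have h : ∀ i, ∃ a : A, σ.scalar a = y.1 i := fun i => mem_gradedPart.1 y.2 i
  choose x hx using h
  exact ⟨x, Subtype.ext (funext hx)⟩

/-- A finitely presented module is the degree zero part of the cokernel of a graded map. -/
theorem exists_cokPart_equiv (σ : Bimodule A) (M : Type u) [AddCommGroup M] [Module Aᵐᵒᵖ M]
    [Module.FinitePresentation Aᵐᵒᵖ M] :
    ∃ (s r : ℕ) (f : σ.Free s →ₗ[σ.TensorAlgᵐᵒᵖ] σ.Free r),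
      IsGraded (fun _ => 0) (fun _ => 0) f ∧
        Nonempty (CokPart f (fun _ => 0) (fun _ => 0) 0 ≃ₗ[Aᵐᵒᵖ] M) := by
  obtain ⟨r, p, hp⟩ := exists_free_surjective (A := A) M
  obtain ⟨s, q, hq⟩ := exists_free_range_eq (Module.FinitePresentation.fg_ker p hp)
  -- The matrix of `q`, read with entries in T_0 = A.
  let f : σ.Free s →ₗ[σ.TensorAlgᵐᵒᵖ] σ.Free r :=
    combo fun j => (σ.scalarMap r (q (Pi.single j 1))).1
  have hf : ∀ a : Fin s → A, f (σ.scalarMap s a).1 = (σ.scalarMap r (q a)).1 := by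
    intro a
    have ha : a = ∑ j, op (a j) • (Pi.single j (1 : A) : Fin s → A) := by
      refine (Finset.univ_sum_single a).symm.trans (Finset.sum_congr rfl fun j _ => ?_)
      rw [← Pi.single_smul]
      simp
    conv_rhs => rw [ha]
    rw [map_sum, map_sum, combo_apply, AddSubmonoidClass.coe_finsetSum]
    refine Finset.sum_congr rfl fun j _ => ?_
    rw [map_smul, map_smul, Submodule.coe_smul, op_smul_free]
    rfl
  refine ⟨s, r, f, isGraded_combo fun j => Subtype.prop _, ?_⟩
  refine nonempty_equiv_of_ker_eq (f := Submodule.mkQ _ ∘ₗ σ.scalarMap r)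
    ((Submodule.mkQ_surjective _).comp (scalarMap_surjective σ r)) hp ?_
  rw [LinearMap.ker_comp, Submodule.ker_mkQ, ← hq]
  ext x
  constructor
  · rintro ⟨y, hy, hyx⟩
    obtain ⟨a, ha⟩ := scalarMap_surjective σ s ⟨y, hy⟩
    refine ⟨a, funext fun i => scalar_injective σ ?_⟩
    have h := hf a
    rw [ha] at h
    exact (congrFun h i).symm.trans (congrFun hyx i)
  · rintro ⟨a, rfl⟩
    exact ⟨(σ.scalarMap s a).1, (σ.scalarMap s a).2, hf a⟩

end Bimodule

end GradedCoherence

end GrCoh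

namespace GrCoh

/-! ## Graded coherence and purity -/

section Main

variable {A : Type u} [Ring A] {σ : Bimodule A}

open Bimodule

/-- If `Tor_1(M ⊗ σ^m, σ^n) = 0` for all `n` and some `m` depending on the finitely presented module
`M`, then the tensor algebra is graded right coherent. -/
theorem isGradedRightCoherent_of_extZero (hA : IsRightCoherent A)
    (hσ : Module.FinitePresentation Aᵐᵒᵖ σ)
    (hpow : ∀ n k, ExtZero (dualModule (σ.pow k)) 1 (σ.pow n))
    (h : ∀ M : ModuleCat.{u} Aᵐᵒᵖ, Module.FinitePresentation Aᵐᵒᵖ M →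
      ∃ m : ℕ, ∀ n, ExtZero (dualModule (σ.pow n)) 1 (Tensor A M (σ.pow m))) :
    IsGradedRightCoherent σ.grading := by
  refine ⟨inferInstance, fun k d f hf => ?_⟩
  -- T is viewed as T^1 so that the results on maps of free modules apply.
  let g : σ.Free k →ₗ[σ.TensorAlgᵐᵒᵖ] σ.Free 1 := LinearMap.pi fun _ => f
  have hg : IsGraded d (fun _ => 0) g := fun n x hx => mem_gradedPart.2 fun j => by
    rw [sub_zero]
    exact hf n x (mem_freeGrading.2 hx)
  have hker : LinearMap.ker f = LinearMap.ker g := by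
    ext x
    exact ⟨fun hx => funext fun _ => hx, fun hx => congrFun hx 0⟩
  obtain ⟨N, hN⟩ := exists_le_natCast d
  -- From degree N on, tensoring the cokernel piece with σ^m only raises its degree, so the
  -- hypothesis on C_N becomes Tor_1 vanishing for C_(N+m).
  obtain ⟨m, hm⟩ := h (ModuleCat.of Aᵐᵒᵖ (CokPart g d (fun _ => 0) N))
    (finitePresentation_cokPart hσ hg N)
  obtain ⟨e⟩ := nonempty_cokPart_tensor_equiv hg (fun j => (hN j).1)
    (fun _ => Int.natCast_nonneg N) m
  rw [← Nat.cast_add] at e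
  rw [hker]
  refine ker_fg_of_kerPart_le (m := N + m) hg (kerPart_fg hσ hA hg) fun n => ?_
  refine kerPart_le_range (fun j => (hN j).1.trans (by simp)) ?_
  rw [← extZero_cokPart_iff hg (extZero_gradedPart (fun m => hpow m n) 1 (N + m))]
  exact (hm n).of_equiv e

/-- Over a graded coherent tensor algebra, a finitely presented module `M` has an eventual syzygy
`K` that computes the higher `Tor` groups of the modules `M ⊗ σ^m`. -/
theorem exists_eventual_syzygy (hA : IsRightCoherent A) (hσ : Module.FinitePresentation Aᵐᵒᵖ σ)
    (hpow : ∀ n k i, ExtZero (dualModule (σ.pow k)) (i + 1) (σ.pow n))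
    (h : IsGradedRightCoherent σ.grading) (M : Type u) [AddCommGroup M] [Module Aᵐᵒᵖ M]
    [Module.FinitePresentation Aᵐᵒᵖ M] :
    ∃ (N : ℕ) (K : ModuleCat.{u} Aᵐᵒᵖ), Module.FinitePresentation Aᵐᵒᵖ K ∧ ∀ j k : ℕ,
      ExtZero (dualModule (σ.pow k)) 1 (Tensor A M (σ.pow (N + j))) ∧
      ∀ i, ExtZero (dualModule (σ.pow k)) (i + 1) (Tensor A K (σ.pow j)) →
        ExtZero (dualModule (σ.pow k)) (i + 2) (Tensor A M (σ.pow (N + j))) := by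
  obtain ⟨s, r, f, hf, ⟨e⟩⟩ := exists_cokPart_equiv σ M
  obtain ⟨N, hN⟩ := exists_kerPart_le h hf
  have hinj : ∀ m : ℕ, N ≤ m → ∀ n, Function.Injective (mulSub (imPart f (fun _ => 0) m) n) :=
    fun m hm n => mulSub_imPart_injective (hN m hm n)
  have hcok : ∀ m : ℕ, Nonempty
      (CokPart f (fun _ => 0) (fun _ => 0) m ≃ₗ[Aᵐᵒᵖ] Tensor A M (σ.pow m)) := by
    intro m
    obtain ⟨e'⟩ := nonempty_cokPart_tensor_equiv hf (m := 0) (fun _ => le_rfl)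
      (fun _ => le_rfl) m
    rw [zero_add] at e'
    exact ⟨e'.symm ≪≫ₗ Tensor.rTensorEquiv (σ.pow m) e⟩
  refine ⟨N, ModuleCat.of Aᵐᵒᵖ (imPart f (fun _ => 0) N), finitePresentation_imPart hσ hA hf N,
    fun j k => ?_⟩
  obtain ⟨e'⟩ := hcok (N + j)
  constructor
  · refine ExtZero.of_equiv e' ?_
    rw [extZero_cokPart_iff hf (extZero_gradedPart (fun m => hpow m k 0) r (N + j))]
    exact hinj _ (Nat.le_add_right N j) k
  · intro i hi
    -- Injective multiplication identifies I_N ⊗ σ^j with I_(N+j), the kernel of G_(N+j) → M ⊗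
    -- σ^(N+j). One dimension shift then finishes.
    have e'' := LinearEquiv.ofInjective _ (hinj N le_rfl j)
    rw [range_mulSub_imPart (fun _ => Int.natCast_nonneg N), ← Nat.cast_add] at e''
    exact ExtZero.of_equiv e' (ExtZero.right (Submodule.inclusion_injective (imPart_le hf _))
      (exact_cokPart hf _) (Submodule.mkQ_surjective _) (hi.of_equiv e'')
      (extZero_gradedPart (fun m => hpow m k (i + 1)) r (N + j)))

/-- Over a graded coherent tensor algebra, `Tor_i(M ⊗ σ^m, σ^k)` vanishes for large `m`. -/
theorem exists_extZero_tensor_pow (hA : IsRightCoherent A)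
    (hσ : Module.FinitePresentation Aᵐᵒᵖ σ)
    (hpow : ∀ n k i, ExtZero (dualModule (σ.pow k)) (i + 1) (σ.pow n))
    (h : IsGradedRightCoherent σ.grading) (i : ℕ) (M : Type u) [AddCommGroup M]
    [Module Aᵐᵒᵖ M] [Module.FinitePresentation Aᵐᵒᵖ M] :
    ∃ N : ℕ, ∀ m, N ≤ m → ∀ k,
      ExtZero (dualModule (σ.pow k)) (i + 1) (Tensor A M (σ.pow m)) := by
  induction i generalizing M with
  | zero =>
    obtain ⟨N, K, -, hK⟩ := exists_eventual_syzygy hA hσ hpow h M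
    refine ⟨N, fun m hm k => ?_⟩
    obtain ⟨j, rfl⟩ := Nat.exists_eq_add_of_le hm
    exact (hK j k).1
  | succ i ih =>
    obtain ⟨N, K, hKfp, hK⟩ := exists_eventual_syzygy hA hσ hpow h M
    -- The syzygy K is finitely presented, so it replaces M one Tor degree lower. The two bounds add
    -- up.
    obtain ⟨N', hN'⟩ := ih K
    refine ⟨N + N', fun m hm k => ?_⟩
    obtain ⟨j, rfl⟩ := Nat.exists_eq_add_of_le (le_of_add_le_left hm)
    exact (hK j k).2 i (hN' j (by omega) k)

/-- Each Tor degree has its own bound on m. Above the right global dimension D nothing is required,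
so the sum of the first D bounds serves for all degrees. -/
theorem exists_derivedTensorPure (hA : IsRightCoherent A)
    (hσ : Module.FinitePresentation Aᵐᵒᵖ σ)
    (hpow : ∀ n k i, ExtZero (dualModule (σ.pow k)) (i + 1) (σ.pow n))
    (hr : FiniteRightGlobalDim A) (h : IsGradedRightCoherent σ.grading) (M : Type u)
    [AddCommGroup M] [Module Aᵐᵒᵖ M] [Module.FinitePresentation Aᵐᵒᵖ M] :
    ∃ m : ℕ, ∀ k i, ExtZero (dualModule (σ.pow k)) (i + 1) (Tensor A M (σ.pow m)) := by
  obtain ⟨D, hD⟩ := hr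
  choose N hN using fun i => exists_extZero_tensor_pow hA hσ hpow h i M
  refine ⟨∑ i ∈ Finset.range D, N i, fun k i => ?_⟩
  rcases lt_or_ge i D with hi | hi
  · exact hN i _ (Finset.single_le_sum (fun _ _ => Nat.zero_le _) (Finset.mem_range.2 hi)) k
  · have := hD (ModuleCat.of Aᵐᵒᵖ (Tensor A M (σ.pow (∑ i ∈ Finset.range D, N i))))
    exact HasProjectiveDimensionLT.subsingleton _ (D + 1) (i + 1) (by omega) _

end Main

end GrCoh

/-! ### Equivalence of graded coherence and eventual purity -/

theorem mainTheorem2 {A : Type u} [Ring A] (hA : GrCoh.IsRightCoherent A)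
    (σ : GrCoh.Bimodule A) (hσfp : Module.FinitePresentation Aᵐᵒᵖ σ)
    (hσpure : ∀ n : ℕ, 1 ≤ n → GrCoh.DerivedPowerPure σ n)
    (hr : GrCoh.FiniteRightGlobalDim A) (hl : GrCoh.FiniteLeftGlobalDim A) :
    GrCoh.IsGradedRightCoherent σ.grading ↔
      ∀ M : ModuleCat.{u} Aᵐᵒᵖ, Module.FinitePresentation Aᵐᵒᵖ M →
        ∃ m : ℕ, ∀ n : ℕ,
          GrCoh.DerivedTensorPure (ModuleCat.of Aᵐᵒᵖ (GrCoh.Tensor A M (σ.pow m))) (σ.pow n) := by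
  have hpow := GrCoh.extZero_pow_pow hA hσfp hσpure
  simp only [GrCoh.derivedTensorPure_iff]
  constructor
  · intro h M hM
    exact GrCoh.exists_derivedTensorPure hA hσfp hpow hr h M
  · intro h
    refine GrCoh.isGradedRightCoherent_of_extZero hA hσfp (fun n k => hpow n k 0) fun M hM => ?_
    obtain ⟨m, hm⟩ := h M hM
    -- For this direction only Tor_1, the case i = 0, is needed.
    exact ⟨m, fun n => hm n 0⟩
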